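/- **Setting.** Let $T,d,n$ be positive integers. A data set $x$ of $n$ samples in $(\mathbb R^d)^T$ is an $\epsilon$-corrupted version of a data set $c$ if it is obtained from $c$ by removing at most $\epsilon n$ samples and replacing them by arbitrary points (data sets are unordered). A (possibly randomized) $T$-round online estimator outputs, for each $t=1,\dots,T$, a vector $\mu_t\in\mathbb R^d$ that is a measurable function of its internal randomness and of the batches $x^{(i)}_s$, $i\le n$, $s\le t$. It estimates the mean $\mu^*$ of a distribution $D$ on $(\mathbb R^d)^T$ under $\epsilon$-corruption with error $\epsilon'$ and failure probability $\tau$ if, whenever $c$ consists of $n$ i.i.d. samples from $D$ and $x$ is a random $\epsilon$-corrupted version of $c$ (chosen with knowledge of all of $c$, but independent of the internal randomness of the estimator), we have $\big(\sum_{t=1}^T\|\mu_t-\mu^*_t\|_2^2\big)^{1/2}\le\epsilon'$ with probability at least $1-\tau$. Let $F:[0,\infty)\to[0,1]$ be monotonically decreasing (not necessarily strictly). An $F$-tail bound $(T\times d)$-block distribution is a product of $T$ distributions $X_1,\dots,X_T$ on $\mathbb R^d$ with $\Pr[\|X_t\|_2\ge q]\le F(q)$ for all $t$ and all $q\ge 0$.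 Put $$Q_{F,\epsilon}=\int_0^\infty\min\big(\epsilon,\sqrt{\epsilon F(q)}\big)\,dq,\qquad L=\inf\Big\{z\ge 0:\int_z^\infty F(q)\,dq\le \tfrac{1}{\sqrt T}\,Q_{F,\epsilon}\Big\}.$$ **Theorem.** There are absolute constants $\epsilon_0>0$, $C>0$, $K\in\mathbb N$ and a polynomial $p$ in two variables such that the following holds for all positive integers $T,d$, all $\epsilon\in(0,1)$ with $\epsilon\le\epsilon_0$, all $\tau\in(0,1)$, and all monotonically decreasing $F:[0,\infty)\to[0,1]$ for which $Q_{F,\epsilon}$ is convergent. For every integer $$n\ \ge\ 2^{K T d^2}\cdot p\big(1/\epsilon,\,1/F(L)\big)\cdot\max\Big(1,\ \log\frac{L}{Q_{F,\epsilon}\,\tau}\Big)$$ there is a $T$-round online estimator for $n$ samples (depending on $n,T,d,\epsilon,\tau,F$ only) which, for every $F$-tail bound $(T\times d)$-block distribution, estimates its mean under $\epsilon$-corruption with error $C\cdot Q_{F,\epsilon}$ and failure probability $\tau$. (In the degenerate case $L=0$ or $Q_{F,\epsilon}=0$ the maximum is read as $1$.) -/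

import Mathlib

open MeasureTheory ProbabilityTheory

noncomputable section

/-- A batch of `d` coordinates, with the Euclidean norm. -/
abbrev Batch (d : ℕ) : Type := EuclideanSpace ℝ (Fin d)

/-- A sample: the concatenation of `T` batches of size `d`. -/
abbrev Sample (T d : ℕ) : Type := Fin T → Batch d

/-- A data set of `n` samples. -/
abbrev Data (n T d : ℕ) : Type := Fin n → Sample T d

/-- `x` is an `ε`-corrupted version of the data set `c` (strong contamination): at most `ε n` of the
samples of `c` have been removed and replaced by arbitrary points. Data sets are compared as
unordered collections, so the surviving samples may also be listed in another order. -/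
def IsCorruptedVersion {n T d : ℕ} (ε : ℝ) (c x : Data n T d) : Prop :=
  ∃ σ : Equiv.Perm (Fin n), (({i | x i ≠ c (σ i)} : Set (Fin n)).ncard : ℝ) ≤ ε * n

/-- A (possibly randomized) estimator for `n` samples in the `T`-round online setting. In round `t`
it sees the batches `s ≤ t` of all samples, and it outputs a point of `ℝ^d`. The random seed is
drawn once, independently of the data, and is available in all rounds. -/
structure OnlineEstimator (n T d : ℕ) where
  /-- The space of random seeds. -/
  Seed : Type
  [seedSpace : MeasurableSpace Seed]
  /-- The distribution of the random seed. -/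
  seedLaw : Measure Seed
  [seedProb : IsProbabilityMeasure seedLaw]
  /-- The output of round `t`. -/
  estimate : (t : Fin T) → Seed → (Fin n → Set.Iic t → Batch d) → Batch d
  measurable_estimate : ∀ t : Fin T,
    Measurable fun p : Seed × (Fin n → Set.Iic t → Batch d) => estimate t p.1 p.2

attribute [instance] OnlineEstimator.seedSpace OnlineEstimator.seedProb

/-- The sequence of outputs of an online estimator on the data set `x` with seed `r`. -/
def OnlineEstimator.run {n T d : ℕ} (A : OnlineEstimator n T d) (x : Data n T d) (r : A.Seed) :
    Sample T d :=
  fun t => A.estimate t r fun i s => x i s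

/-- The `t`-th batch of the mean vector of a distribution `D` on `(ℝ^d)^T`. -/
def batchMean {T d : ℕ} (D : Measure (Sample T d)) (t : Fin T) : Batch d :=
  ∫ y, y t ∂D

/-- The `ℓ²` distance between two vectors of `(ℝ^d)^T = ℝ^{Td}`. -/
def l2Dist {T d : ℕ} (u v : Sample T d) : ℝ :=
  Real.sqrt (∑ t, ‖u t - v t‖ ^ 2)

/-- The online estimator `A` estimates the mean of `D` under `ε`-corruption in the `T`-round online
setting with error `err` and failure probability `τ`, from `n` samples. The clean data set consists
of `n` i.i.d. samples from `D`; the observed data set is any random data set that is always an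
`ε`-corrupted version of it, so that the adversary may use the whole clean data set and randomness
of its own. The seed of the estimator is independent of both. -/
def OnlineEstimator.EstimatesMean {n T d : ℕ} (A : OnlineEstimator n T d)
    (D : Measure (Sample T d)) (ε err τ : ℝ) : Prop :=
  ∀ (Ω : Type) [MeasurableSpace Ω] (P : Measure Ω) [IsProbabilityMeasure P]
    (clean observed : Ω → Data n T d),
    HasLaw clean (Measure.pi fun _ : Fin n => D) P →
    Measurable observed →
    (∀ ω, IsCorruptedVersion ε (clean ω) (observed ω)) →
    ENNReal.ofReal (1 - τ) ≤
      (P.prod A.seedLaw) {p | l2Dist (A.run (observed p.1) p.2) (batchMean D) ≤ err}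

/-- `F` is a monotonically decreasing function `[0, ∞) → [0, 1]`; the values of `F` at negative
reals are irrelevant. -/
structure IsTailFunction (F : ℝ → ℝ) : Prop where
  antitoneOn : AntitoneOn F (Set.Ici 0)
  mem_Icc : ∀ q, 0 ≤ q → F q ∈ Set.Icc (0 : ℝ) 1

/-- `D` is an `F`-tail bound `(T × d)`-block distribution: the product of `T` distributions on
`ℝ^d`, each of which satisfies `Pr[‖X_t‖ ≥ q] ≤ F q`. -/
def IsTailBoundBlock {T d : ℕ} (F : ℝ → ℝ) (D : Measure (Sample T d)) : Prop :=
  ∃ X : Fin T → Measure (Batch d), (∀ t, IsProbabilityMeasure (X t)) ∧ D = Measure.pi X ∧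
    ∀ t q, 0 ≤ q → X t {y | q ≤ ‖y‖} ≤ ENNReal.ofReal (F q)

/-- The integrand of `Q_{F,ε}`. -/
def rateIntegrand (F : ℝ → ℝ) (ε q : ℝ) : ℝ := min ε (Real.sqrt (ε * F q))

/-- `Q_{F,ε} = ∫_0^∞ min(ε, √(ε F(q))) dq`. -/
def rateQ (F : ℝ → ℝ) (ε : ℝ) : ℝ := ∫ q in Set.Ioi (0 : ℝ), rateIntegrand F ε q

/-- `L`, the infimum of the `z ≥ 0` with `∫_z^∞ F(q) dq ≤ Q_{F,ε} / √T`. -/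
def cutoffL (F : ℝ → ℝ) (ε : ℝ) (T : ℕ) : ℝ :=
  sInf {z : ℝ | 0 ≤ z ∧ ∫ q in Set.Ioi z, F q ≤ rateQ F ε / Real.sqrt T}

end

/-! Every batch is cut into layers of width `s = Q/ε`. Each rescaled layer is replaced by the
weights of its unbiased rounding to a finite grid (`sum_roundWeight_smul_letterVal`). For each layer
the data then give a distribution `p` on words of `T` letters. Hoeffding and a union bound over the
`2^O(T d²)` words put the clean empirical distribution within `ε` of a product law `D` in ℓ¹.
Replacing `ε n` samples moves it by at most `2ε`, so `p` is within `δ = 3ε` of `D`.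

In round `t` every history `h` of `t` letters yields a conditional mean of the next letter under
`p`. Under `D` this mean would not depend on `h`. The estimator outputs a medoid of these means,
weighted by `p`, which is accurate as soon as most histories are (`norm_medoid_sub_le`).

The error does not accumulate over rounds because of a potential. Write `p = D + δ (A - A')` with
`A`, `A'` nonnegative of mass at most 1, and let `Φ t` be the sum of `harm (A t h) (D t h)` over
`h`. Since `harm` is concave and homogeneous, `Φ` is nonincreasing, and it stays in `[0, 1]`. Its
loss in a round is a chi-square type distance between the next letter under `A` and under `D`
(`harm_sub_sum`). By Cauchy–Schwarz this loss, with that of `A'`, controls the squared error of the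
round (`min_sq_le_harm_sub`, `norm_medoid_condMean_sq_le`). Telescoping bounds the total squared
error by a constant times `min (δ²) (δ f)`, where `f` bounds the probability of reaching the layer
(`sum_norm_medoid_sub_sq_le`).

Adding the layers gives a Riemann sum for `Q` (`sum_rateIntegrand_le`). Truncation just beyond `L`
costs at most `Q / √T` per round, hence `Q` in total. -/

/-! ### The potential and its decrease in one round -/

/-- Half the harmonic mean, the perspective of the concave function `r ↦ r / (1 + r)`. -/
noncomputable def harm (a b : ℝ) : ℝ := a * b / (a + b)

lemma harm_nonneg {a b : ℝ} (ha : 0 ≤ a) (hb : 0 ≤ b) : 0 ≤ harm a b := by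
  unfold harm; positivity

lemma harm_le_left {a b : ℝ} (ha : 0 ≤ a) (hb : 0 ≤ b) : harm a b ≤ a := by
  unfold harm
  exact div_le_of_le_mul₀ (by positivity) ha (by nlinarith [mul_nonneg ha ha])

section Potential
variable {Y : Type*} [Fintype Y]

/-- The decrease of `harm` when a pair `(a, b)` is split into the pairs `(u y, b * q y)`. -/
lemma harm_sub_sum {a b : ℝ} {u q : Y → ℝ} (hb : 0 < b) (ha : 0 ≤ a) (hu : ∀ y, 0 ≤ u y)
    (hq : ∀ y, 0 ≤ q y) (hua : ∑ y, u y = a) (hq1 : ∑ y, q y = 1) :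
    harm a b - ∑ y, harm (u y) (b * q y) =
      (b / (a + b)) ^ 2 * ∑ y, (u y - a * q y) ^ 2 / (u y + b * q y) := by
  have hab : a + b ≠ 0 := by positivity
  have h1 : ∀ y, harm (u y) (b * q y) = (b ^ 2 * u y + a ^ 2 * b * q y) / (a + b) ^ 2 -
      (b / (a + b)) ^ 2 * ((u y - a * q y) ^ 2 / (u y + b * q y)) := by
    intro y
    unfold harm
    have hbq : 0 ≤ b * q y := mul_nonneg hb.le (hq y)
    rcases eq_or_ne (u y + b * q y) 0 with h0 | h0
    · have h2 : u y = 0 := by linarith [hu y]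
      have h3 : q y = 0 := by
        rcases mul_eq_zero.1 (show b * q y = 0 by linarith) with h | h
        · exact absurd h hb.ne'
        · exact h
      simp [h2, h3]
    · field_simp
      ring
  simp_rw [h1, Finset.sum_sub_distrib, ← Finset.mul_sum, ← Finset.sum_div, Finset.sum_add_distrib,
    ← Finset.mul_sum, hua, hq1]
  unfold harm
  field_simp
  ring

lemma sum_harm_le {a b : ℝ} {u q : Y → ℝ} (hb : 0 ≤ b) (ha : 0 ≤ a) (hu : ∀ y, 0 ≤ u y)
    (hq : ∀ y, 0 ≤ q y) (hua : ∑ y, u y = a) (hq1 : ∑ y, q y = 1) :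
    ∑ y, harm (u y) (b * q y) ≤ harm a b := by
  rcases hb.eq_or_lt with rfl | hb
  · simp [harm]
  · have h := harm_sub_sum hb ha hu hq hua hq1
    have : 0 ≤ (b / (a + b)) ^ 2 * ∑ y, (u y - a * q y) ^ 2 / (u y + b * q y) :=
      mul_nonneg (sq_nonneg _) (Finset.sum_nonneg fun y _ =>
        div_nonneg (sq_nonneg _) (add_nonneg (hu y) (mul_nonneg hb.le (hq y))))
    linarith

/-- The scalar core of the rate. The bound with `δ ^ 2` uses only `h1`. For the bound with `δ * f`,
if `δ * x ≤ f` then the term `x` in `h2` is absorbed after multiplying by `δ`; otherwise `f ≤ x`, so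
`h2` becomes linear in `x`. -/
lemma min_sq_le_of_sq_le {l x f δ ℓ : ℝ} (hl : 0 ≤ l) (hx : 0 ≤ x) (hf : 0 ≤ f) (hδ : 0 < δ)
    (hδ1 : δ ≤ 1) (hℓ : 0 ≤ ℓ) (h1 : x ^ 2 ≤ (1 + l) * ℓ) (h2 : x ^ 2 ≤ ℓ * ((1 + l) * f + x)) :
    min (δ * x) f ^ 2 ≤ (2 + l) * min (δ ^ 2) (δ * f) * ℓ := by
  have hm : 0 ≤ min (δ * x) f := le_min (by positivity) hf
  have key1 : min (δ * x) f ^ 2 ≤ (2 + l) * δ ^ 2 * ℓ := by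
    calc min (δ * x) f ^ 2 ≤ (δ * x) ^ 2 := pow_le_pow_left₀ hm (min_le_left _ _) 2
      _ = δ ^ 2 * x ^ 2 := by ring
      _ ≤ δ ^ 2 * ((1 + l) * ℓ) := by gcongr
      _ ≤ _ := by nlinarith [mul_nonneg (sq_nonneg δ) hℓ]
  have key2 : min (δ * x) f ^ 2 ≤ (2 + l) * (δ * f) * ℓ := by
    rcases le_total (δ * x) f with h | h
    · rw [min_eq_left h]
      have h3 : (δ * x) ^ 2 ≤ δ * ℓ * (δ * ((1 + l) * f) + δ * x) := by
        have := mul_le_mul_of_nonneg_left h2 (sq_nonneg δ)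
        nlinarith
      have h4 : δ * ((1 + l) * f) ≤ 1 * ((1 + l) * f) := by gcongr
      calc (δ * x) ^ 2 ≤ δ * ℓ * (δ * ((1 + l) * f) + δ * x) := h3
        _ ≤ δ * ℓ * (1 * ((1 + l) * f) + f) := by gcongr
        _ = _ := by ring
    · rw [min_eq_right h]
      have hfx : f ≤ x := h.trans (by nlinarith)
      have h3 : x ≤ (2 + l) * ℓ := by
        rcases hx.eq_or_lt with h0 | h0
        · rw [← h0]; positivity
        · have : x * x ≤ (2 + l) * ℓ * x := by
            calc x * x = x ^ 2 := by ring
              _ ≤ ℓ * ((1 + l) * f + x) := h2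
              _ ≤ ℓ * ((1 + l) * x + x) := by gcongr
              _ = _ := by ring
          exact le_of_mul_le_mul_right this h0
      calc f ^ 2 = f * f := by ring
        _ ≤ f * (δ * x) := by gcongr
        _ ≤ f * (δ * ((2 + l) * ℓ)) := by gcongr
        _ = _ := by ring
  rcases le_total (δ ^ 2) (δ * f) with h | h
  · rwa [min_eq_left h]
  · rwa [min_eq_right h]

/-- The transport of `u` away from the product `a * q`, on the letters in `S`, is paid for by the
decrease of `harm`. -/
lemma min_sq_le_harm_sub {a b l f δ : ℝ} {u q : Y → ℝ} (S : Finset Y) (hl : 0 ≤ l) (hb : 0 < b)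
    (ha : 0 ≤ a) (hal : a ≤ l * b) (hu : ∀ y, 0 ≤ u y) (hq : ∀ y, 0 ≤ q y) (hua : ∑ y, u y = a)
    (hq1 : ∑ y, q y = 1) (hf : ∑ y ∈ S, q y ≤ f) (hδ : 0 < δ) (hδ1 : δ ≤ 1) :
    b * min (δ * ((∑ y ∈ S, |u y - a * q y|) / b)) f ^ 2 ≤
      (2 + l) * (1 + l) ^ 2 * min (δ ^ 2) (δ * f) *
        (harm a b - ∑ y, harm (u y) (b * q y)) := by
  set X := ∑ y ∈ S, |u y - a * q y| with hX
  set Λ := ∑ y, (u y - a * q y) ^ 2 / (u y + b * q y) with hΛ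
  have hden : ∀ y, 0 ≤ u y + b * q y := fun y => add_nonneg (hu y) (mul_nonneg hb.le (hq y))
  have hΛ0 : 0 ≤ Λ := Finset.sum_nonneg fun y _ => div_nonneg (sq_nonneg _) (hden y)
  have hX0 : 0 ≤ X := Finset.sum_nonneg fun y _ => abs_nonneg _
  have hf0 : 0 ≤ f := (Finset.sum_nonneg fun y _ => hq y).trans hf
  -- Cauchy–Schwarz with weights `u y + b * q y`, whose mass on `S` is then bounded in two ways: by
  -- the total mass, and by the rarity of `S` under `q` plus the deviation `X` itself.
  have hcs : X ^ 2 ≤ Λ * ∑ y ∈ S, (u y + b * q y) := by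
    have h1 : X ^ 2 ≤ (∑ y ∈ S, (u y - a * q y) ^ 2 / (u y + b * q y)) *
        ∑ y ∈ S, (u y + b * q y) := by
      refine Finset.sum_sq_le_sum_mul_sum_of_sq_le_mul S
        (fun y _ => div_nonneg (sq_nonneg _) (hden y)) (fun y _ => hden y) fun y _ => ?_
      rw [sq_abs]
      rcases eq_or_ne (u y + b * q y) 0 with h0 | h0
      · have hbq : 0 ≤ b * q y := mul_nonneg hb.le (hq y)
        have h2 : u y = 0 := by linarith [hu y]
        have h3 : q y = 0 := by
          rcases mul_eq_zero.1 (show b * q y = 0 by linarith [hu y]) with h | h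
          · exact absurd h hb.ne'
          · exact h
        simp [h2, h3]
      · exact (div_mul_cancel₀ _ h0).ge
    refine h1.trans (mul_le_mul_of_nonneg_right ?_ (Finset.sum_nonneg fun y _ => hden y))
    exact Finset.sum_le_sum_of_subset_of_nonneg (Finset.subset_univ S)
      fun y _ _ => div_nonneg (sq_nonneg _) (hden y)
  have hS1 : ∑ y ∈ S, (u y + b * q y) ≤ (1 + l) * b := by
    calc ∑ y ∈ S, (u y + b * q y) ≤ ∑ y, (u y + b * q y) :=
          Finset.sum_le_sum_of_subset_of_nonneg (Finset.subset_univ S) fun y _ _ => hden y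
      _ = a + b := by rw [Finset.sum_add_distrib, ← Finset.mul_sum, hua, hq1, mul_one]
      _ ≤ _ := by linarith
  have hS2 : ∑ y ∈ S, (u y + b * q y) ≤ (1 + l) * f * b + X := by
    calc ∑ y ∈ S, (u y + b * q y) ≤ ∑ y ∈ S, ((a + b) * q y + |u y - a * q y|) :=
          Finset.sum_le_sum fun y _ => by linarith [le_abs_self (u y - a * q y)]
      _ = (a + b) * ∑ y ∈ S, q y + X := by rw [Finset.sum_add_distrib, ← Finset.mul_sum]
      _ ≤ ((1 + l) * b) * f + X := by
          gcongr
          · exact Finset.sum_nonneg fun y _ => hq y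
          · linarith
      _ = _ := by ring
  have hmain := min_sq_le_of_sq_le (x := X / b) (ℓ := Λ / b) hl (by positivity) hf0 hδ hδ1
    (by positivity)
    (by
      rw [div_pow, div_le_iff₀ (by positivity)]
      calc X ^ 2 ≤ Λ * ((1 + l) * b) := hcs.trans (by gcongr)
        _ = _ := by field_simp)
    (by
      rw [div_pow, div_le_iff₀ (by positivity)]
      calc X ^ 2 ≤ Λ * ((1 + l) * f * b + X) := hcs.trans (by gcongr)
        _ = _ := by field_simp)
  rw [harm_sub_sum hb ha hu hq hua hq1, ← hΛ]
  have hη : 0 ≤ min (δ ^ 2) (δ * f) := le_min (by positivity) (by positivity)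
  -- Undoes the factor `(b / (a + b)) ^ 2` of `harm_sub_sum`, using `a ≤ l * b`.
  have hr : 1 ≤ (1 + l) ^ 2 * (b / (a + b)) ^ 2 := by
    rw [← mul_pow]
    refine one_le_pow₀ ?_
    rw [← mul_div_assoc, one_le_div (by positivity)]
    linarith
  calc b * min (δ * (X / b)) f ^ 2 ≤ b * ((2 + l) * min (δ ^ 2) (δ * f) * (Λ / b)) := by gcongr
    _ = (2 + l) * min (δ ^ 2) (δ * f) * Λ * 1 := by field_simp
    _ ≤ (2 + l) * min (δ ^ 2) (δ * f) * Λ * ((1 + l) ^ 2 * (b / (a + b)) ^ 2) := by gcongr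
    _ = _ := by ring

end Potential

/-! ### Robustness of medoids -/

section Medoid
variable {E : Type*} [SeminormedAddCommGroup E] {H : Type*} [Fintype H]

/-- A medoid of a weighted family is close to every point to which most of the family is close. -/
lemma norm_medoid_sub_le {p : H → ℝ} {m : H → E} {μ : E} {h₀ : H} (G : Finset H)
    (hp : ∀ h, 0 ≤ p h) (hp1 : ∑ h, p h = 1) (hG : 3 / 4 ≤ ∑ h ∈ G, p h)
    (hmin : ∀ h', ∑ h, p h * ‖m h - m h₀‖ ≤ ∑ h, p h * ‖m h - m h'‖) :
    ‖m h₀ - μ‖ ≤ 8 * ∑ h ∈ G, p h * ‖m h - μ‖ := by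
  classical
  set A := ∑ h ∈ G, p h * ‖m h - μ‖ with hA
  have hA0 : 0 ≤ A := Finset.sum_nonneg fun h _ => mul_nonneg (hp h) (norm_nonneg _)
  -- Markov's inequality on `G`, of mass at least `3 / 4`, gives a competitor for the medoid near
  -- `μ`.
  obtain ⟨h₁, -, hh₁⟩ : ∃ h ∈ G, ‖m h - μ‖ ≤ 4 / 3 * A := by
    by_contra! hcon
    have h2 : ∑ h ∈ G, p h * (4 / 3 * A) ≤ A :=
      Finset.sum_le_sum fun h hh => mul_le_mul_of_nonneg_left (hcon h hh).le (hp h)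
    rw [← Finset.sum_mul] at h2
    have hne : ∃ h ∈ G, 0 < p h := by
      by_contra! h0
      linarith [Finset.sum_nonpos h0]
    obtain ⟨h, hhG, hph⟩ := hne
    have h3 : ∑ h ∈ G, p h * (4 / 3 * A) < A :=
      Finset.sum_lt_sum (fun h hh => mul_le_mul_of_nonneg_left (hcon h hh).le (hp h))
        ⟨h, hhG, mul_lt_mul_of_pos_left (hcon h hhG) hph⟩
    rw [← Finset.sum_mul] at h3
    nlinarith
  set v := m h₀ with hv
  have hlow : ∑ h, p h * (‖m h - v‖ - ‖m h - μ‖) ≤ 4 / 3 * A := by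
    have h3 : ∑ h, p h * (‖m h - m h₁‖ - ‖m h - μ‖) ≤ ∑ h, p h * (4 / 3 * A) :=
      Finset.sum_le_sum fun h _ => mul_le_mul_of_nonneg_left (by
        have := norm_sub_le_norm_sub_add_norm_sub (m h) μ (m h₁)
        rw [norm_sub_rev μ] at this
        linarith) (hp h)
    rw [← Finset.sum_mul, hp1, one_mul] at h3
    simp_rw [mul_sub, Finset.sum_sub_distrib] at h3 ⊢
    linarith [hmin h₁]
  have hgood : ∑ h ∈ G, p h * (‖v - μ‖ - 2 * ‖m h - μ‖) ≤
      ∑ h ∈ G, p h * (‖m h - v‖ - ‖m h - μ‖) :=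
    Finset.sum_le_sum fun h _ => mul_le_mul_of_nonneg_left (by
      have := norm_sub_le_norm_sub_add_norm_sub v (m h) μ
      rw [norm_sub_rev v (m h)] at this
      linarith) (hp h)
  -- Members outside `G` are arbitrary, but each can favour `v` over `μ` by at most `‖v - μ‖`; their
  -- mass is at most `1 / 4`.
  have hbad : ∑ h ∈ Gᶜ, p h * (-‖v - μ‖) ≤ ∑ h ∈ Gᶜ, p h * (‖m h - v‖ - ‖m h - μ‖) :=
    Finset.sum_le_sum fun h _ => mul_le_mul_of_nonneg_left (by
      have := norm_sub_le_norm_sub_add_norm_sub (m h) v μ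
      linarith) (hp h)
  have hsum := Finset.sum_add_sum_compl G fun h => p h * (‖m h - v‖ - ‖m h - μ‖)
  have hps := Finset.sum_add_sum_compl G p
  have e1 : ∑ h ∈ G, p h * (‖v - μ‖ - 2 * ‖m h - μ‖) = (∑ h ∈ G, p h) * ‖v - μ‖ - 2 * A := by
    rw [hA, Finset.mul_sum, Finset.sum_mul, ← Finset.sum_sub_distrib]
    exact Finset.sum_congr rfl fun h _ => by ring
  rw [e1] at hgood
  rw [← Finset.sum_mul] at hbad
  nlinarith [norm_nonneg (v - μ)]

end Medoid

/-! ### Radial clipping -/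

section Clip
variable {E : Type*} [NormedAddCommGroup E] [NormedSpace ℝ E]

/-- The point of the segment from `0` to `x` whose norm is `r`, or `x` itself if `‖x‖ ≤ r`. -/
noncomputable def clip (r : ℝ) (x : E) : E := min 1 (r / ‖x‖) • x

omit [NormedSpace ℝ E] in
lemma min_one_div_mul_norm {r : ℝ} (hr : 0 ≤ r) (x : E) : min 1 (r / ‖x‖) * ‖x‖ = min ‖x‖ r := by
  rcases eq_or_ne x 0 with rfl | hx
  · simp [hr]
  · rw [min_mul_of_nonneg _ _ (norm_nonneg x), one_mul, div_mul_cancel₀ _ (norm_ne_zero_iff.2 hx)]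

lemma norm_clip {r : ℝ} (hr : 0 ≤ r) (x : E) : ‖clip r x‖ = min ‖x‖ r := by
  rw [clip, norm_smul, Real.norm_of_nonneg (le_min zero_le_one (by positivity)),
    min_one_div_mul_norm hr]

lemma norm_clip_sub_clip {r s : ℝ} (hr : 0 ≤ r) (hs : 0 ≤ s) (x : E) :
    ‖clip r x - clip s x‖ = |min ‖x‖ r - min ‖x‖ s| := by
  rw [clip, clip, ← sub_smul, norm_smul, Real.norm_eq_abs, ← abs_of_nonneg (norm_nonneg x),
    ← abs_mul, sub_mul, abs_of_nonneg (norm_nonneg x), min_one_div_mul_norm hr,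
    min_one_div_mul_norm hs]

lemma norm_sub_clip {r : ℝ} (hr : 0 ≤ r) (x : E) : ‖x - clip r x‖ = ‖x‖ - min ‖x‖ r := by
  have h : (1 - min 1 (r / ‖x‖)) * ‖x‖ = ‖x‖ - min ‖x‖ r := by
    rw [sub_mul, one_mul, min_one_div_mul_norm hr]
  have h0 : 0 ≤ 1 - min 1 (r / ‖x‖) := sub_nonneg.2 (min_le_left _ _)
  rw [← h, clip, show x - min 1 (r / ‖x‖) • x = (1 - min 1 (r / ‖x‖)) • x by rw [sub_smul, one_smul],
    norm_smul, Real.norm_of_nonneg h0]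

lemma clip_zero_left (x : E) : clip 0 x = 0 := by simp [clip]

/-- Clipping moves `x` by the excess of `‖x‖` over `r`, which is at most `‖x - μ‖` because `‖μ‖ ≤
r`. -/
lemma norm_clip_sub_le {r : ℝ} (x : E) {μ : E} (hμ : ‖μ‖ ≤ r) :
    ‖clip r x - μ‖ ≤ 2 * ‖x - μ‖ := by
  have hr : 0 ≤ r := (norm_nonneg μ).trans hμ
  have h1 : ‖x - clip r x‖ ≤ ‖x - μ‖ := by
    rw [norm_sub_clip hr]
    rcases le_total ‖x‖ r with h | h
    · rw [min_eq_left h, sub_self]; exact norm_nonneg _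
    · rw [min_eq_right h]
      linarith [norm_sub_norm_le x μ]
  have h2 := norm_sub_le_norm_sub_add_norm_sub (clip r x) x μ
  rw [norm_sub_rev _ x] at h2
  linarith

lemma measurable_clip [MeasurableSpace E] [BorelSpace E] [SecondCountableTopology E] (r : ℝ) :
    Measurable (clip r : E → E) := by
  unfold clip
  fun_prop

end Clip

/-! ### The error of one round -/

section Round
variable {E : Type*} [NormedAddCommGroup E] [NormedSpace ℝ E] {Y H : Type*} [Fintype Y] [Fintype H]

lemma min_add_add_le {x y f : ℝ} (hx : 0 ≤ x) (hy : 0 ≤ y) (hf : 0 ≤ f) :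
    min (8 * (x + y)) (4 * f) ≤ 8 * (min x f + min y f) := by
  rcases le_total x f with h1 | h1 <;> rcases le_total y f with h2 | h2 <;>
    simp only [h1, h2, min_eq_left, min_eq_right]
  · exact (min_le_left _ _)
  all_goals exact (min_le_right _ _).trans (by linarith)

/-- One round: the medoid of the conditional means of the corrupted distribution `b + δ (a - a')` is
close to the true mean, up to the decrease of the two potentials. -/
lemma norm_medoid_condMean_sq_le {δ f : ℝ} {b a a' p : H → ℝ} {u u' w : H → Y → ℝ} {q : Y → ℝ}
    {val : Y → E} {h₀ : H} {m : H → E}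
    (hδ : 0 < δ) (hδ1 : δ ≤ 1 / 32)
    (hb : ∀ h, 0 ≤ b h)
    (ha : ∀ h, 0 ≤ a h) (ha1 : ∑ h, a h ≤ 1) (ha' : ∀ h, 0 ≤ a' h) (ha1' : ∑ h, a' h ≤ 1)
    (hu : ∀ h y, 0 ≤ u h y) (hua : ∀ h, ∑ y, u h y = a h)
    (hu' : ∀ h y, 0 ≤ u' h y) (hua' : ∀ h, ∑ y, u' h y = a' h)
    (hq : ∀ y, 0 ≤ q y) (hq1 : ∑ y, q y = 1)
    (hval : ∀ y, ‖val y‖ ≤ 2) (S : Finset Y) (hS : ∀ y, y ∉ S → val y = 0) (hf : ∑ y ∈ S, q y ≤ f)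
    (hp : ∀ h, 0 ≤ p h) (hp1 : ∑ h, p h = 1) (hpb : ∀ h, p h = b h + δ * (a h - a' h))
    (hw : ∀ h y, w h y = b h * q y + δ * (u h y - u' h y))
    (hm : ∀ h, m h = clip (2 * f) ((p h)⁻¹ • ∑ y, w h y • val y))
    (hmin : ∀ h', ∑ h, p h * ‖m h - m h₀‖ ≤ ∑ h, p h * ‖m h - m h'‖) :
    ‖m h₀ - ∑ y, q y • val y‖ ^ 2 ≤ 10 ^ 8 * min (δ ^ 2) (δ * f) *
      ∑ h, ((harm (a h) (b h) - ∑ y, harm (u h y) (b h * q y)) +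
        (harm (a' h) (b h) - ∑ y, harm (u' h y) (b h * q y))) := by
  classical
  set μ := ∑ y, q y • val y with hμ
  have hf0 : 0 ≤ f := (Finset.sum_nonneg fun y _ => hq y).trans hf
  have sum_val : ∀ c : Y → ℝ, ‖∑ y, c y • val y‖ ≤ 2 * ∑ y ∈ S, |c y| := by
    intro c
    rw [← Finset.sum_subset (Finset.subset_univ S) fun y _ hy => by rw [hS y hy, smul_zero],
      Finset.mul_sum]
    refine (norm_sum_le _ _).trans (Finset.sum_le_sum fun y _ => ?_)
    rw [norm_smul, Real.norm_eq_abs, mul_comm]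
    exact mul_le_mul_of_nonneg_right (hval y) (abs_nonneg _)
  have hμf : ‖μ‖ ≤ 2 * f := by
    refine (sum_val q).trans ?_
    simp_rw [abs_of_nonneg (hq _)]
    linarith
  set loss : H → ℝ := fun h => harm (a h) (b h) - ∑ y, harm (u h y) (b h * q y) with hloss
  set loss' : H → ℝ := fun h => harm (a' h) (b h) - ∑ y, harm (u' h y) (b h * q y) with hloss'
  have hloss0 : ∀ h, 0 ≤ loss h := fun h =>
    sub_nonneg.2 (sum_harm_le (hb h) (ha h) (hu h) hq (hua h) hq1)
  have hloss0' : ∀ h, 0 ≤ loss' h := fun h =>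
    sub_nonneg.2 (sum_harm_le (hb h) (ha' h) (hu' h) hq (hua' h) hq1)
  -- The histories on which neither part of the corruption dominates. As `16 * δ ≤ 1 / 2`, there `p
  -- h` lies between `b h / 2` and `3 / 2 * b h`.
  set G : Finset H := Finset.univ.filter fun h => a h ≤ 16 * b h ∧ a' h ≤ 16 * b h with hG
  set η := min (δ ^ 2) (δ * f) with hη
  have hη0 : 0 ≤ η := le_min (by positivity) (by positivity)
  -- Off `G`, `b h` is below a sixteenth of `a h` or of `a' h`, so the mass there is at most `1 / 16
  -- + 1 / 32 + 1 / 16`.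
  have hGp : 3 / 4 ≤ ∑ h ∈ G, p h := by
    have h1 : ∑ h ∈ Gᶜ, p h ≤ ∑ h ∈ Gᶜ, ((1 / 16 + δ) * a h + 1 / 16 * a' h) := by
      refine Finset.sum_le_sum fun h hh => ?_
      have hh' : ¬(a h ≤ 16 * b h ∧ a' h ≤ 16 * b h) := by simpa [hG] using hh
      rw [hpb]
      have h3 : 0 ≤ δ * a' h := mul_nonneg hδ.le (ha' h)
      rcases not_and_or.1 hh' with h2 | h2 <;> push Not at h2 <;>
        nlinarith [ha h, ha' h]
    have h2 : ∑ h ∈ Gᶜ, ((1 / 16 + δ) * a h + 1 / 16 * a' h) ≤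
        ∑ h, ((1 / 16 + δ) * a h + 1 / 16 * a' h) :=
      Finset.sum_le_sum_of_subset_of_nonneg (Finset.subset_univ _) fun h _ _ => by
        have := ha h; have := ha' h; positivity
    have h4 := h1.trans h2
    rw [Finset.sum_add_distrib, ← Finset.mul_sum, ← Finset.mul_sum] at h4
    have h3 := Finset.sum_add_sum_compl G p
    nlinarith
  have hgood : ∀ h ∈ G, p h * ‖m h - μ‖ ^ 2 ≤
      3 / 2 * 128 * 5202 * η * (loss h + loss' h) := by
    intro h hh
    obtain ⟨hg, hg'⟩ : a h ≤ 16 * b h ∧ a' h ≤ 16 * b h := by simpa [hG] using hh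
    rcases (hb h).eq_or_lt with hb0 | hb0
    · have : p h = 0 := by
        rw [hpb, ← hb0, show a h = 0 by linarith [ha h], show a' h = 0 by linarith [ha' h]]; simp
      rw [this, zero_mul]
      have := hloss0 h; have := hloss0' h; positivity
    have hpl : b h / 2 ≤ p h := by
      rw [hpb]
      have := mul_le_mul_of_nonneg_left hg' hδ.le
      have := mul_nonneg hδ.le (ha h)
      nlinarith
    have hpu : p h ≤ 3 / 2 * b h := by
      rw [hpb]
      have := mul_le_mul_of_nonneg_left hg hδ.le
      have := mul_nonneg hδ.le (ha' h)
      nlinarith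
    have hp0 : 0 < p h := by linarith
    set x := (∑ y ∈ S, |u h y - a h * q y|) / b h with hx
    set x' := (∑ y ∈ S, |u' h y - a' h * q y|) / b h with hx'
    have hx0 : 0 ≤ x := by positivity
    have hx0' : 0 ≤ x' := by positivity
    -- The uncorrupted part `b h * q y` cancels, so the deviation comes only from `u` and `u'`, with
    -- a factor `δ`.
    have hdev : ‖(p h)⁻¹ • ∑ y, w h y • val y - μ‖ ≤ 4 * (δ * x + δ * x') := by
      have e1 : (p h)⁻¹ • ∑ y, w h y • val y - μ =
          (p h)⁻¹ • ∑ y, (w h y - p h * q y) • val y := by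
        simp_rw [sub_smul, Finset.sum_sub_distrib, smul_sub, mul_smul, ← Finset.smul_sum]
        rw [inv_smul_smul₀ hp0.ne']
      rw [e1, norm_smul, norm_inv, Real.norm_of_nonneg hp0.le]
      have e2 : ∑ y ∈ S, |w h y - p h * q y| ≤ δ * (b h * x + b h * x') := by
        rw [hx, hx', mul_div_cancel₀ _ hb0.ne', mul_div_cancel₀ _ hb0.ne',
          ← Finset.sum_add_distrib, Finset.mul_sum]
        refine Finset.sum_le_sum fun y _ => ?_
        rw [hw, hpb, show b h * q y + δ * (u h y - u' h y) - (b h + δ * (a h - a' h)) * q y =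
          δ * ((u h y - a h * q y) - (u' h y - a' h * q y)) by ring, abs_mul, abs_of_pos hδ]
        exact mul_le_mul_of_nonneg_left (abs_sub _ _) hδ.le
      calc (p h)⁻¹ * ‖∑ y, (w h y - p h * q y) • val y‖
          ≤ (b h / 2)⁻¹ * (2 * (δ * (b h * x + b h * x'))) := by
            gcongr
            exact (sum_val _).trans (by gcongr)
        _ = _ := by field_simp; ring
    -- Both `m h` and `μ` have norm at most `2 * f`; this caps the error at `4 * f` and produces the
    -- truncated quantities `min (δ * x) f` of `min_sq_le_harm_sub`.
    have hmh : ‖m h - μ‖ ≤ 8 * (min (δ * x) f + min (δ * x') f) := by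
      refine le_trans (le_min ?_ ?_) (min_add_add_le (by positivity) (by positivity) hf0)
      · rw [hm]
        linarith [norm_clip_sub_le ((p h)⁻¹ • ∑ y, w h y • val y) hμf]
      · refine (norm_sub_le _ _).trans ?_
        have : ‖m h‖ ≤ 2 * f := by
          rw [hm, norm_clip (by positivity)]; exact min_le_right _ _
        linarith
    -- The constant 5202 is `(2 + l) * (1 + l) ^ 2` at `l = 16`.
    have k := min_sq_le_harm_sub S (l := 16) (by norm_num) hb0 (ha h) hg (hu h) hq (hua h) hq1 hf
      hδ (by linarith)
    have k' := min_sq_le_harm_sub S (l := 16) (by norm_num) hb0 (ha' h) hg' (hu' h) hq (hua' h)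
      hq1 hf hδ (by linarith)
    norm_num only at k k'
    set r := min (δ * x) f
    set r' := min (δ * x') f
    calc p h * ‖m h - μ‖ ^ 2 ≤ (3 / 2 * b h) * (8 * (r + r')) ^ 2 := by gcongr
      _ ≤ (3 / 2 * b h) * (128 * (r ^ 2 + r' ^ 2)) := by
          gcongr
          nlinarith [sq_nonneg (r - r')]
      _ = 3 / 2 * 128 * (b h * r ^ 2 + b h * r' ^ 2) := by ring
      _ ≤ 3 / 2 * 128 * (5202 * η * loss h + 5202 * η * loss' h) := by gcongr
      _ = _ := by ring
  have hmed := norm_medoid_sub_le (μ := μ) G hp hp1 hGp hmin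
  have hcs : (∑ h ∈ G, p h * ‖m h - μ‖) ^ 2 ≤ ∑ h ∈ G, p h * ‖m h - μ‖ ^ 2 := by
    have h1 := Finset.sum_sq_le_sum_mul_sum_of_sq_le_mul G (r := fun h => p h * ‖m h - μ‖)
      (f := p) (g := fun h => p h * ‖m h - μ‖ ^ 2) (fun h _ => hp h)
      (fun h _ => mul_nonneg (hp h) (sq_nonneg _)) (fun h _ => by nlinarith)
    refine h1.trans (mul_le_of_le_one_left (Finset.sum_nonneg fun h _ =>
      mul_nonneg (hp h) (sq_nonneg _)) ?_)
    rw [← hp1]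
    exact Finset.sum_le_sum_of_subset_of_nonneg (Finset.subset_univ _) fun h _ _ => hp h
  have hL : 0 ≤ ∑ h, (loss h + loss' h) :=
    Finset.sum_nonneg fun h _ => add_nonneg (hloss0 h) (hloss0' h)
  calc ‖m h₀ - μ‖ ^ 2 ≤ (8 * ∑ h ∈ G, p h * ‖m h - μ‖) ^ 2 := by gcongr
    _ = 64 * (∑ h ∈ G, p h * ‖m h - μ‖) ^ 2 := by ring
    _ ≤ 64 * ∑ h ∈ G, 3 / 2 * 128 * 5202 * η * (loss h + loss' h) := by
        gcongr
        exact hcs.trans (Finset.sum_le_sum hgood)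
    _ ≤ 64 * ∑ h, 3 / 2 * 128 * 5202 * η * (loss h + loss' h) := by
        gcongr
        · exact fun h _ _ => mul_nonneg (by positivity) (add_nonneg (hloss0 h) (hloss0' h))
        · exact Finset.subset_univ _
    _ = (64 * (3 / 2 * 128 * 5202)) * (η * ∑ h, (loss h + loss' h)) := by
        rw [← Finset.mul_sum]; ring
    _ ≤ 10 ^ 8 * (η * ∑ h, (loss h + loss' h)) := by
        gcongr; norm_num
    _ = _ := by ring

end Round

/-! ### Consistent families of weights on words -/

section Families
variable {Y : Type*}

/-- The word `h` followed by the letter `y`. -/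
def addLetter {k : ℕ} (h : Fin k → Y) (y : Y) : Fin (k + 1) → Y := Fin.snoc (α := fun _ => Y) h y

lemma sum_addLetter [Fintype Y] {k : ℕ} (g : (Fin (k + 1) → Y) → ℝ) :
    ∑ h, g h = ∑ h : Fin k → Y, ∑ y, g (addLetter h y) := by
  rw [← (Fin.snocEquiv fun _ : Fin (k + 1) => Y).sum_comp, Fintype.sum_prod_type_right]
  rfl

/-- A family of functions on the words of each length, each of which is, up to length `T`, the
marginal of the next one. -/
def IsConsistent [Fintype Y] (T : ℕ) (M : ∀ k, (Fin k → Y) → ℝ) : Prop :=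
  ∀ k < T, ∀ h, ∑ y, M (k + 1) (addLetter h y) = M k h

/-- The weight of a word if letters are chosen independently. -/
def wordWeight (u : ℕ → Y → ℝ) (k : ℕ) (h : Fin k → Y) : ℝ := ∏ s : Fin k, u s (h s)

lemma wordWeight_addLetter (u : ℕ → Y → ℝ) {k : ℕ} (h : Fin k → Y) (y : Y) :
    wordWeight u (k + 1) (addLetter h y) = wordWeight u k h * u k y := by
  simp [wordWeight, addLetter, Fin.prod_univ_castSucc]

lemma wordWeight_nonneg {u : ℕ → Y → ℝ} (hu : ∀ s y, 0 ≤ u s y) (k : ℕ) (h : Fin k → Y) :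
    0 ≤ wordWeight u k h := Finset.prod_nonneg fun _ _ => hu _ _

lemma wordWeight_congr {u v : ℕ → Y → ℝ} {k : ℕ} (huv : ∀ s < k, u s = v s) (h : Fin k → Y) :
    wordWeight u k h = wordWeight v k h :=
  Finset.prod_congr rfl fun s _ => by rw [huv s s.2]

variable [Fintype Y] {T : ℕ}

lemma isConsistent_wordWeight {u : ℕ → Y → ℝ} (hu : ∀ s, ∑ y, u s y = 1) :
    IsConsistent T (wordWeight u) := fun k _ h => by
  simp_rw [wordWeight_addLetter, ← Finset.mul_sum, hu, mul_one]

lemma sum_wordWeight {u : ℕ → Y → ℝ} (hu : ∀ s, ∑ y, u s y = 1) (k : ℕ) :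
    ∑ h, wordWeight u k h = 1 := by
  induction k with
  | zero => simp [wordWeight]
  | succ k ih =>
    rw [sum_addLetter]
    simp_rw [wordWeight_addLetter, ← Finset.mul_sum, hu, mul_one, ih]

lemma IsConsistent.sum_eq {M : ∀ k, (Fin k → Y) → ℝ} (hM : IsConsistent T M) {k : ℕ} (hk : k ≤ T) :
    ∑ h, M k h = ∑ z, M T z := by
  induction hk using Nat.decreasingInduction with
  | self => rfl
  | of_succ k hk ih =>
    rw [← ih, sum_addLetter]
    exact Finset.sum_congr rfl fun h _ => (hM k hk h).symm

lemma IsConsistent.eq_of_eq {M M' : ∀ k, (Fin k → Y) → ℝ} (hM : IsConsistent T M)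
    (hM' : IsConsistent T M') (hT : M T = M' T) {k : ℕ} (hk : k ≤ T) : M k = M' k := by
  induction hk using Nat.decreasingInduction with
  | self => exact hT
  | of_succ k hk ih =>
    ext h
    rw [← hM k hk, ← hM' k hk, ih]

/-- The family of marginals of `g`. The guard `s < T` only serves to make the formula meaningful for
lengths beyond `T`. -/
lemma exists_isConsistent (g : (Fin T → Y) → ℝ) (hg : ∀ z, 0 ≤ g z) :
    ∃ M : ∀ k, (Fin k → Y) → ℝ, IsConsistent T M ∧ M T = g ∧ ∀ k h, 0 ≤ M k h := by
  classical
  refine ⟨fun k h => ∑ z, if ∀ (s : Fin k) (hs : (s : ℕ) < T), z ⟨s, hs⟩ = h s then g z else 0,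
    fun k hk h => ?_, ?_, fun k h => Finset.sum_nonneg fun z _ => ?_⟩
  · rw [Finset.sum_comm]
    refine Finset.sum_congr rfl fun z _ => ?_
    have h1 : ∀ y, (∀ (s : Fin (k + 1)) (hs : (s : ℕ) < T), z ⟨s, hs⟩ = addLetter h y s) ↔
        (∀ (s : Fin k) (hs : (s : ℕ) < T), z ⟨s, hs⟩ = h s) ∧ z ⟨k, hk⟩ = y := by
      intro y
      simp [Fin.forall_fin_succ', addLetter, hk]
    simp_rw [h1, ite_and]
    split_ifs
    · simp
    · simp
  · ext z
    have h1 : ∀ z', (∀ (s : Fin T) (hs : (s : ℕ) < T), z' ⟨s, hs⟩ = z s) ↔ z' = z := fun z' =>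
      ⟨fun h => funext fun s => h s s.2, fun h s _ => by rw [h]⟩
    simp_rw [h1]
    simp
  · split_ifs
    · exact hg z
    · exact le_rfl

end Families

/-! ### All rounds together -/

section Rounds
variable {E : Type*} [NormedAddCommGroup E] [NormedSpace ℝ E] {Y : Type*} [Fintype Y]

/-- The mean of the next letter given the word `h`, clipped to norm at most `r`. -/
noncomputable def condMean (r : ℝ) (val : Y → E) (p : ∀ k, (Fin k → Y) → ℝ) (t : ℕ)
    (h : Fin t → Y) : E :=
  clip r ((p t h)⁻¹ • ∑ y, p (t + 1) (addLetter h y) • val y)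

/-- The word `h₀` minimises the average distance of the clipped conditional means. -/
def IsMedoid (r : ℝ) (val : Y → E) (p : ∀ k, (Fin k → Y) → ℝ) (t : ℕ) (h₀ : Fin t → Y) : Prop :=
  ∀ h', ∑ h, p t h * ‖condMean r val p t h - condMean r val p t h₀‖ ≤
    ∑ h, p t h * ‖condMean r val p t h - condMean r val p t h'‖

/-- The sum telescopes to `Φ 0 - Φ T`. Here `Φ T` is nonnegative and `Φ 0` is at most the mass of
`A`, since `harm a b ≤ a`. -/
lemma sum_range_harm_sub_le {T : ℕ} {q : ℕ → Y → ℝ} {A : ∀ k, (Fin k → Y) → ℝ}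
    (hq : ∀ s y, 0 ≤ q s y) (hA : IsConsistent T A) (hA0 : ∀ k h, 0 ≤ A k h)
    (hA1 : ∑ z, A T z ≤ 1) :
    ∑ t ∈ Finset.range T, ∑ h : Fin t → Y, (harm (A t h) (wordWeight q t h) -
      ∑ y, harm (A (t + 1) (addLetter h y)) (wordWeight q t h * q t y)) ≤ 1 := by
  set Φ : ℕ → ℝ := fun k => ∑ h : Fin k → Y, harm (A k h) (wordWeight q k h) with hΦ
  have h1 : ∀ t, ∑ h : Fin t → Y, (harm (A t h) (wordWeight q t h) -
      ∑ y, harm (A (t + 1) (addLetter h y)) (wordWeight q t h * q t y)) = Φ t - Φ (t + 1) := by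
    intro t
    simp_rw [hΦ, sum_addLetter, wordWeight_addLetter, Finset.sum_sub_distrib]
  simp_rw [h1, Finset.sum_range_sub']
  have h2 : 0 ≤ Φ T := Finset.sum_nonneg fun h _ => harm_nonneg (hA0 _ _) (wordWeight_nonneg hq _ _)
  have h3 : Φ 0 ≤ ∑ h, A 0 h :=
    Finset.sum_le_sum fun h _ => harm_le_left (hA0 _ _) (wordWeight_nonneg hq _ _)
  rw [hA.sum_eq (Nat.zero_le T)] at h3
  linarith

/-- If a distribution on words is close in total variation to a product distribution, then the
medoids of its conditional means are close to the true means, with an error that does not grow with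
the number of rounds. -/
theorem sum_norm_medoid_sub_sq_le {T : ℕ} {q : ℕ → Y → ℝ} {p : ∀ k, (Fin k → Y) → ℝ} {val : Y → E}
    {δ f : ℝ} {h₀ : ∀ t, Fin t → Y} (hδ : 0 < δ) (hδ1 : δ ≤ 1 / 32)
    (hq : ∀ s y, 0 ≤ q s y) (hq1 : ∀ s, ∑ y, q s y = 1)
    (hval : ∀ y, ‖val y‖ ≤ 2) (S : Finset Y) (hS : ∀ y, y ∉ S → val y = 0)
    (hf0 : 0 ≤ f) (hf : ∀ s < T, ∑ y ∈ S, q s y ≤ f)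
    (hp : IsConsistent T p) (hp0 : ∀ k h, 0 ≤ p k h) (hp1 : ∑ z, p T z = 1)
    (hpq : ∑ z, |p T z - wordWeight q T z| ≤ δ)
    (hmed : ∀ t < T, IsMedoid (2 * f) val p t (h₀ t)) :
    ∑ t ∈ Finset.range T, ‖condMean (2 * f) val p t (h₀ t) - ∑ y, q t y • val y‖ ^ 2 ≤
      10 ^ 9 * min (δ ^ 2) (δ * f) := by
  set D := wordWeight q with hD
  have hDc : IsConsistent T D := isConsistent_wordWeight hq1
  -- Jordan decomposition of `(p T - D T) / δ`, extended to all lengths by marginals. By consistency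
  -- `p = D + δ * (A - A')` then holds at every length up to `T`.
  obtain ⟨A, hA, hAT, hA0⟩ := exists_isConsistent (fun z => max (p T z - D T z) 0 / δ)
    fun z => by positivity
  obtain ⟨A', hA', hAT', hA0'⟩ := exists_isConsistent (fun z => max (-(p T z - D T z)) 0 / δ)
    fun z => by positivity
  have hA1 : ∑ z, A T z ≤ 1 := by
    rw [hAT, ← Finset.sum_div, div_le_one hδ]
    exact (Finset.sum_le_sum fun z _ => max_le (le_abs_self _) (abs_nonneg _)).trans hpq
  have hA1' : ∑ z, A' T z ≤ 1 := by
    rw [hAT', ← Finset.sum_div, div_le_one hδ]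
    exact (Finset.sum_le_sum fun z _ => max_le (neg_le_abs _) (abs_nonneg _)).trans hpq
  have hpd : ∀ k ≤ T, ∀ h, p k h = D k h + δ * (A k h - A' k h) := by
    intro k hk h
    refine congrFun (hp.eq_of_eq (M' := fun k h => D k h + δ * (A k h - A' k h)) ?_ ?_ hk) h
    · intro k hk h
      simp only [Finset.sum_add_distrib, ← Finset.mul_sum, Finset.sum_sub_distrib, hA k hk h,
        hA' k hk h, hDc k hk h]
    · ext z
      simp only [hAT, hAT']
      rw [← sub_div, mul_div_cancel₀ _ hδ.ne']
      have : max (p T z - D T z) 0 - max (-(p T z - D T z)) 0 = p T z - D T z := by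
        rcases le_total (p T z - D T z) 0 with h | h
        · rw [max_eq_right h, max_eq_left (by linarith)]; ring
        · rw [max_eq_left h, max_eq_right (by linarith)]; ring
      rw [this]; ring
  have hround : ∀ t ∈ Finset.range T,
      ‖condMean (2 * f) val p t (h₀ t) - ∑ y, q t y • val y‖ ^ 2 ≤
      10 ^ 8 * min (δ ^ 2) (δ * f) *
        (∑ h : Fin t → Y, (harm (A t h) (D t h) -
          ∑ y, harm (A (t + 1) (addLetter h y)) (D t h * q t y)) +
        ∑ h : Fin t → Y, (harm (A' t h) (D t h) -
          ∑ y, harm (A' (t + 1) (addLetter h y)) (D t h * q t y))) := by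
    intro t ht
    have ht := Finset.mem_range.1 ht
    rw [← Finset.sum_add_distrib]
    refine norm_medoid_condMean_sq_le (p := p t) (a := A t) (a' := A' t) (b := D t)
      (w := fun h y => p (t + 1) (addLetter h y))
      hδ hδ1 (fun h => wordWeight_nonneg hq _ _)
      (hA0 t) ?_ (hA0' t) ?_ (fun h y => hA0 _ _) (hA t ht) (fun h y => hA0' _ _) (hA' t ht)
      (hq t) (hq1 t) hval S hS (hf t ht) (hp0 t) ?_ (hpd t ht.le) (fun h y => ?_)
      (fun h => rfl) (hmed t ht)
    · rwa [hA.sum_eq ht.le]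
    · rwa [hA'.sum_eq ht.le]
    · rwa [hp.sum_eq ht.le]
    · rw [hpd (t + 1) ht, hD, wordWeight_addLetter]
  refine (Finset.sum_le_sum hround).trans ?_
  rw [← Finset.mul_sum, Finset.sum_add_distrib]
  have k1 := sum_range_harm_sub_le hq hA hA0 hA1
  have k2 := sum_range_harm_sub_le hq hA' hA0' hA1'
  have hη : 0 ≤ min (δ ^ 2) (δ * f) := le_min (by positivity) (by positivity)
  nlinarith

end Rounds

/-! ### Unbiased rounding to a grid -/

section Rounding

/-- The hat function, supported on `[-1, 1]`. -/
noncomputable def hat (u : ℝ) : ℝ := max 0 (1 - |u|)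

lemma hat_nonneg (u : ℝ) : 0 ≤ hat u := le_max_left _ _

lemma hat_eq_zero {u : ℝ} (hu : 1 ≤ |u|) : hat u = 0 := max_eq_left (by linarith)

lemma hat_eq {u : ℝ} (hu : |u| ≤ 1) : hat u = 1 - |u| := max_eq_right (by linarith)

lemma abs_lt_one_of_hat_ne_zero {u : ℝ} (hu : hat u ≠ 0) : |u| < 1 :=
  lt_of_not_ge fun h => hu (hat_eq_zero h)

lemma measurable_hat : Measurable hat := by
  unfold hat
  fun_prop

/-- Hats at consecutive integers form a partition of unity and reproduce linear functions. Only the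
first case is used later; the descent of the last hat and the region beyond it carry the induction.
-/
lemma sum_range_hat (m : ℕ) {u : ℝ} (hu : 0 ≤ u) :
    (u ≤ m → ∑ j ∈ Finset.range (m + 1), hat (u - j) = 1 ∧
      ∑ j ∈ Finset.range (m + 1), hat (u - j) * j = u) ∧
    (m ≤ u → u ≤ m + 1 → ∑ j ∈ Finset.range (m + 1), hat (u - j) = m + 1 - u ∧
      ∑ j ∈ Finset.range (m + 1), hat (u - j) * j = (m + 1 - u) * m) ∧
    (m + 1 ≤ u → ∑ j ∈ Finset.range (m + 1), hat (u - j) = 0 ∧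
      ∑ j ∈ Finset.range (m + 1), hat (u - j) * j = 0) := by
  induction m with
  | zero =>
    simp only [zero_add, Finset.range_one, Finset.sum_singleton, Nat.cast_zero, sub_zero, mul_zero]
    refine ⟨fun h => ?_, fun _ h => ⟨?_, trivial⟩, fun h => ⟨?_, trivial⟩⟩
    · have : u = 0 := le_antisymm h hu
      simp [this, hat]
    · rw [hat_eq (by rwa [abs_of_nonneg hu]), abs_of_nonneg hu]
    · exact hat_eq_zero (by rwa [abs_of_nonneg hu])
  | succ m ih =>
    obtain ⟨ih1, ih2, ih3⟩ := ih
    simp only [Finset.sum_range_succ _ (m + 1)]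
    push_cast
    refine ⟨fun h => ?_, fun h h' => ?_, fun h => ?_⟩
    · rcases le_total u m with h1 | h1
      · rw [(ih1 h1).1, (ih1 h1).2, hat_eq_zero (by rw [abs_sub_comm, abs_of_nonneg] <;> linarith)]
        simp
      · rw [(ih2 h1 h).1, (ih2 h1 h).2, hat_eq (by rw [abs_sub_comm, abs_of_nonneg] <;> linarith),
          abs_sub_comm, abs_of_nonneg (by linarith)]
        constructor <;> ring
    · rw [(ih3 h).1, (ih3 h).2, hat_eq (by rw [abs_of_nonneg] <;> linarith),
        abs_of_nonneg (by linarith)]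
      constructor <;> ring
    · rw [(ih3 (by linarith)).1, (ih3 (by linarith)).2,
        hat_eq_zero (by rw [abs_of_nonneg] <;> linarith)]
      simp

/-- Letters: the points of a grid of mesh `1 / d` in `[-1, 1]^d`. -/
abbrev Letter (d : ℕ) : Type := Fin d → Fin (2 * d + 1)

/-- The grid point of a letter. -/
noncomputable def gridPoint {d : ℕ} (y : Letter d) : Batch d :=
  WithLp.toLp 2 fun i => ((y i : ℝ) - d) / d

/-- The grid point of a letter, clipped so that it has norm at most `2`. -/
noncomputable def letterVal {d : ℕ} (y : Letter d) : Batch d := clip 2 (gridPoint y)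

/-- The probability of the letter `y` under the unbiased randomized rounding of `g`. -/
noncomputable def roundWeight {d : ℕ} (g : Batch d) (y : Letter d) : ℝ :=
  ∏ i, hat (d * g i + d - y i)

variable {d : ℕ}

lemma roundWeight_nonneg (g : Batch d) (y : Letter d) : 0 ≤ roundWeight g y :=
  Finset.prod_nonneg fun _ _ => hat_nonneg _

lemma measurable_roundWeight (y : Letter d) : Measurable fun g : Batch d => roundWeight g y := by
  unfold roundWeight
  refine Finset.measurable_prod _ fun i _ => measurable_hat.comp ?_
  fun_prop

lemma norm_letterVal_le (y : Letter d) : ‖letterVal y‖ ≤ 2 := by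
  rw [letterVal, norm_clip zero_le_two]
  exact min_le_right _ _

lemma sum_hat_coord {g : Batch d} (hg : ‖g‖ ≤ 1) (i : Fin d) :
    ∑ j : Fin (2 * d + 1), hat (d * g i + d - j) = 1 ∧
      ∑ j : Fin (2 * d + 1), hat (d * g i + d - j) * j = d * g i + d := by
  have h1 : |g i| ≤ 1 := (PiLp.norm_apply_le g i).trans hg
  have hd : (0 : ℝ) ≤ d := Nat.cast_nonneg d
  have h2 := abs_le.1 h1
  have h := (sum_range_hat (2 * d) (u := d * g i + d) (by nlinarith)).1 (by push_cast; nlinarith)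
  rwa [Finset.sum_range, Finset.sum_range] at h

lemma sum_roundWeight {g : Batch d} (hg : ‖g‖ ≤ 1) : ∑ y, roundWeight g y = 1 := by
  unfold roundWeight
  rw [← Fintype.prod_sum fun (i : Fin d) (j : Fin (2 * d + 1)) => hat (d * g i + d - j)]
  exact Finset.prod_eq_one fun i _ => (sum_hat_coord hg i).1

/-- A letter of nonzero weight differs from `g` by at most `1 / d` per coordinate, so by at most `1
/ √d ≤ 1` in norm. Its grid point thus has norm at most `2` and clipping leaves it alone. -/
lemma letterVal_eq_gridPoint {g : Batch d} (hg : ‖g‖ ≤ 1) {y : Letter d}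
    (hy : roundWeight g y ≠ 0) : letterVal y = gridPoint y := by
  rcases d.eq_zero_or_pos with rfl | hd
  · exact Subsingleton.elim _ _
  have hd' : (1 : ℝ) ≤ d := by exact_mod_cast hd
  have h1 : ‖g - gridPoint y‖ ≤ 1 := by
    rw [EuclideanSpace.norm_eq, Real.sqrt_le_one]
    have h2 : ∀ i, ‖(g - gridPoint y) i‖ ^ 2 ≤ (1 / d : ℝ) := by
      intro i
      have h3 := (abs_lt_one_of_hat_ne_zero (Finset.prod_ne_zero_iff.1 hy i (Finset.mem_univ i))).le
      have h4 : (g - gridPoint y) i = (d * g i + d - y i) / d := by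
        simp [gridPoint]
        field_simp
        ring
      rw [h4, Real.norm_eq_abs, sq_abs, div_pow, ← sq_abs, sq (d : ℝ), ← div_div]
      gcongr
      have h5 : |d * g i + d - (y i : ℝ)| ^ 2 ≤ 1 := pow_le_one₀ (abs_nonneg _) h3
      exact (div_le_self (by positivity) hd').trans h5
    refine (Finset.sum_le_sum fun i _ => h2 i).trans ?_
    simp [mul_inv_cancel₀ (by positivity : (d : ℝ) ≠ 0)]
  have h6 : ‖gridPoint y‖ ≤ 2 := by
    have := norm_sub_norm_le (gridPoint y) g
    rw [norm_sub_rev] at this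
    linarith
  have h7 := norm_sub_clip zero_le_two (gridPoint y)
  rw [min_eq_left h6, sub_self, norm_eq_zero, sub_eq_zero] at h7
  exact h7.symm

lemma sum_roundWeight_smul_letterVal {g : Batch d} (hg : ‖g‖ ≤ 1) :
    ∑ y, roundWeight g y • letterVal y = g := by
  rcases d.eq_zero_or_pos with rfl | hd
  · exact Subsingleton.elim _ _
  have hd' : (d : ℝ) ≠ 0 := by positivity
  have h1 : ∀ y, roundWeight g y • letterVal y = roundWeight g y • gridPoint y := by
    intro y
    rcases eq_or_ne (roundWeight g y) 0 with h | h
    · simp [h]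
    · rw [letterVal_eq_gridPoint hg h]
  simp_rw [h1]
  ext k
  have h2 : (∑ y, roundWeight g y • gridPoint y) k = ∑ y, roundWeight g y * ((y k : ℝ) - d) / d := by
    simp [gridPoint, mul_div_assoc]
  have h3 : ∑ y : Letter d, roundWeight g y * (y k : ℝ) = d * g k + d := by
    have h4 : ∀ y : Letter d, roundWeight g y * (y k : ℝ) =
        ∏ i, hat (d * g i + d - y i) * (if i = k then (y i : ℝ) else 1) := by
      intro y
      rw [Finset.prod_mul_distrib, Finset.prod_ite_eq' Finset.univ k]
      simp [roundWeight]
    simp_rw [h4]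
    rw [← Fintype.prod_sum fun (i : Fin d) (j : Fin (2 * d + 1)) =>
      hat (d * g i + d - j) * (if i = k then (j : ℝ) else 1), Finset.prod_eq_single k]
    · simpa using (sum_hat_coord hg k).2
    · intro i _ hik
      simpa [hik] using (sum_hat_coord hg i).1
    · simp
  rw [h2, ← Finset.sum_div]
  simp_rw [mul_sub]
  rw [Finset.sum_sub_distrib, h3, ← Finset.sum_mul, sum_roundWeight hg]
  field_simp
  ring

/-- The origin is a grid point, so it is rounded only to itself. Hence a sample that does not reach
a layer gives no weight to nonzero letters there. -/
lemma letterVal_eq_zero_of_roundWeight_zero {y : Letter d}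
    (hy : roundWeight (0 : Batch d) y ≠ 0) : letterVal y = 0 := by
  rw [letterVal_eq_gridPoint (by simp) hy]
  ext i
  have h3 := abs_lt_one_of_hat_ne_zero (Finset.prod_ne_zero_iff.1 hy i (Finset.mem_univ i))
  have h4 : ((y i : ℕ) : ℝ) = d := by
    simp only [PiLp.zero_apply, mul_zero, zero_add, abs_lt] at h3
    have h5 : ((y i : ℕ) : ℝ) < d + 1 := by linarith [h3.1]
    have h6 : (d : ℝ) < (y i : ℕ) + 1 := by linarith [h3.2]
    have h7 : (y i : ℕ) < d + 1 := by exact_mod_cast h5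
    have h8 : d < (y i : ℕ) + 1 := by exact_mod_cast h6
    exact_mod_cast (by omega : (y i : ℕ) = d)
  simp [gridPoint, h4]

lemma roundWeight_le_one {g : Batch d} (hg : ‖g‖ ≤ 1) (y : Letter d) : roundWeight g y ≤ 1 := by
  rw [← sum_roundWeight hg]
  exact Finset.single_le_sum (fun z _ => roundWeight_nonneg g z) (Finset.mem_univ y)

end Rounding

/-! ### Layers of a batch and their letter laws -/

section Layers
variable {d : ℕ}

/-- The part of `x` in the layer `j s ≤ ‖x‖ ≤ (j + 1) s`, rescaled to norm at most `1`. -/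
noncomputable def layer (s : ℝ) (j : ℕ) (x : Batch d) : Batch d :=
  s⁻¹ • (clip ((j + 1) * s) x - clip (j * s) x)

lemma measurable_layer (s : ℝ) (j : ℕ) : Measurable (layer s j : Batch d → Batch d) := by
  unfold layer
  have h : Measurable fun x : Batch d => clip ((j + 1) * s) x - clip (j * s) x :=
    (measurable_clip _).sub (measurable_clip _)
  exact h.const_smul s⁻¹

lemma norm_layer_le {s : ℝ} (hs : 0 < s) (j : ℕ) (x : Batch d) : ‖layer s j x‖ ≤ 1 := by
  rw [layer, norm_smul, norm_inv, Real.norm_of_nonneg hs.le, inv_mul_le_iff₀ hs, mul_one,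
    norm_clip_sub_clip (by positivity) (by positivity)]
  refine (abs_min_sub_min_le_max _ _ _ _).trans ?_
  rw [sub_self, abs_zero, ← sub_mul, add_sub_cancel_left, one_mul, abs_of_pos hs,
    max_eq_right hs.le]

lemma layer_eq_zero {s : ℝ} (hs : 0 < s) {j : ℕ} {x : Batch d} (hx : ‖x‖ ≤ j * s) :
    layer s j x = 0 := by
  have h : ‖clip ((j + 1) * s) x - clip (j * s) x‖ = 0 := by
    rw [norm_clip_sub_clip (by positivity) (by positivity), min_eq_left (by nlinarith),
      min_eq_left hx, sub_self, abs_zero]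
  rw [layer, norm_eq_zero.1 h, smul_zero]

lemma sum_smul_layer {s : ℝ} (hs : 0 < s) (J : ℕ) (x : Batch d) :
    ∑ j ∈ Finset.range J, s • layer s j x = clip (J * s) x := by
  simp_rw [layer, smul_inv_smul₀ hs.ne']
  have := Finset.sum_range_sub (fun j : ℕ => clip ((j : ℝ) * s) x) J
  push_cast at this
  rw [this, zero_mul, clip_zero_left, sub_zero]

/-- The probability of the letter `y` under the rounding of the `j`-th layer of `x`. -/
noncomputable def layerWeight (s : ℝ) (j : ℕ) (x : Batch d) (y : Letter d) : ℝ :=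
  roundWeight (layer s j x) y

lemma layerWeight_nonneg (s : ℝ) (j : ℕ) (x : Batch d) (y : Letter d) : 0 ≤ layerWeight s j x y :=
  roundWeight_nonneg _ _

lemma layerWeight_le_one {s : ℝ} (hs : 0 < s) (j : ℕ) (x : Batch d) (y : Letter d) :
    layerWeight s j x y ≤ 1 :=
  roundWeight_le_one (norm_layer_le hs j x) _

lemma sum_layerWeight {s : ℝ} (hs : 0 < s) (j : ℕ) (x : Batch d) : ∑ y, layerWeight s j x y = 1 :=
  sum_roundWeight (norm_layer_le hs j x)

lemma measurable_layerWeight (s : ℝ) (j : ℕ) (y : Letter d) :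
    Measurable fun x : Batch d => layerWeight s j x y :=
  (measurable_roundWeight y).comp (measurable_layer s j)

lemma integrable_layerWeight {s : ℝ} (hs : 0 < s) (j : ℕ) (y : Letter d) (μ : Measure (Batch d))
    [IsFiniteMeasure μ] : Integrable (fun x => layerWeight s j x y) μ :=
  Integrable.of_mem_Icc 0 1 (measurable_layerWeight s j y).aemeasurable
    (ae_of_all _ fun x => ⟨layerWeight_nonneg s j x y, layerWeight_le_one hs j x y⟩)

lemma sum_integral_layerWeight {s : ℝ} (hs : 0 < s) (j : ℕ) (μ : Measure (Batch d))
    [IsProbabilityMeasure μ] : ∑ y, ∫ x, layerWeight s j x y ∂μ = 1 := by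
  rw [← integral_finsetSum _ fun y _ => integrable_layerWeight hs j y μ]
  simp [sum_layerWeight hs]

lemma sum_integral_layerWeight_smul {s : ℝ} (hs : 0 < s) (j : ℕ) (μ : Measure (Batch d))
    [IsProbabilityMeasure μ] :
    ∑ y, (∫ x, layerWeight s j x y ∂μ) • letterVal y = ∫ x, layer s j x ∂μ := by
  simp_rw [← integral_smul_const]
  rw [← integral_finsetSum _ fun y _ => (integrable_layerWeight hs j y μ).smul_const _]
  simp_rw [layerWeight, sum_roundWeight_smul_letterVal (norm_layer_le hs j _)]

open Classical in
/-- The letters with a nonzero value. -/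
noncomputable def nonzeroLetters (d : ℕ) : Finset (Letter d) :=
  Finset.univ.filter fun y => letterVal y ≠ 0

lemma letterVal_eq_zero {y : Letter d} (hy : y ∉ nonzeroLetters d) : letterVal y = 0 := by
  simpa [nonzeroLetters] using hy

lemma sum_nonzero_integral_layerWeight_le {s f : ℝ} (hs : 0 < s) (j : ℕ) (μ : Measure (Batch d))
    [IsProbabilityMeasure μ] (hf : 0 ≤ f) (hμ : μ {x | j * s ≤ ‖x‖} ≤ ENNReal.ofReal f) :
    ∑ y ∈ nonzeroLetters d, ∫ x, layerWeight s j x y ∂μ ≤ f := by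
  rw [← integral_finsetSum _ fun y _ => integrable_layerWeight hs j y μ]
  have hms : MeasurableSet {x : Batch d | j * s ≤ ‖x‖} :=
    measurableSet_le measurable_const measurable_norm
  calc ∫ x, ∑ y ∈ nonzeroLetters d, layerWeight s j x y ∂μ
      ≤ ∫ x, Set.indicator {x : Batch d | j * s ≤ ‖x‖} 1 x ∂μ := by
        refine integral_mono (integrable_finsetSum _ fun y _ => integrable_layerWeight hs j y μ)
          ((integrable_const (1 : ℝ)).indicator hms) fun x => ?_
        by_cases hx : j * s ≤ ‖x‖
        · rw [Set.indicator_of_mem (by exact hx), Pi.one_apply, ← sum_layerWeight hs j x]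
          exact Finset.sum_le_sum_of_subset_of_nonneg (Finset.subset_univ _)
            fun y _ _ => layerWeight_nonneg s j x y
        · rw [Set.indicator_of_notMem (by exact hx)]
          refine (Finset.sum_eq_zero fun y hy => ?_).le
          rw [layerWeight, layer_eq_zero hs (not_le.1 hx).le]
          by_contra h0
          have := letterVal_eq_zero_of_roundWeight_zero h0
          simp [nonzeroLetters, this] at hy
    _ = μ.real {x | j * s ≤ ‖x‖} := integral_indicator_one hms
    _ ≤ f := ENNReal.toReal_le_of_le_ofReal hf hμ

end Layers

/-! ### Measurable choice of a minimiser -/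

section Selection

/-- Measurable selection of a minimiser from a finite family. -/
lemma exists_measurable_argmin {Ω E ι : Type*} [MeasurableSpace Ω] [MeasurableSpace E] [Finite ι]
    [Nonempty ι] {f : ι → Ω → ℝ} (hf : ∀ i, Measurable (f i)) {m : ι → Ω → E}
    (hm : ∀ i, Measurable (m i)) :
    ∃ v : Ω → E, Measurable v ∧ ∀ ω, ∃ i, v ω = m i ω ∧ ∀ i', f i ω ≤ f i' ω := by
  classical
  obtain ⟨N, ⟨e⟩⟩ := Finite.exists_equiv_fin ι
  have hex : ∀ ω, ∃ k : ℕ, ∃ hk : k < N, ∀ i', f (e.symm ⟨k, hk⟩) ω ≤ f i' ω := by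
    intro ω
    obtain ⟨i, hi⟩ := Finite.exists_min fun i => f i ω
    exact ⟨e i, (e i).2, fun i' => by simpa using hi i'⟩
  -- Ties are broken by the least index in a fixed enumeration, which makes the choice measurable.
  set g : Ω → ℕ := fun ω => Nat.find (hex ω) with hg
  have hgm : Measurable g := by
    refine measurable_find hex fun k => ?_
    by_cases hk : k < N
    · simp only [hk, exists_true_left, Set.ofPred_forall]
      exact MeasurableSet.iInter fun i' => measurableSet_le (hf _) (hf _)
    · simp [hk]
  have hgN : ∀ ω, g ω < N := fun ω => (Nat.find_spec (hex ω)).1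
  refine ⟨fun ω => m (e.symm ⟨g ω, hgN ω⟩) ω, fun s hs => ?_,
    fun ω => ⟨_, rfl, (Nat.find_spec (hex ω)).2⟩⟩
  have : (fun ω => m (e.symm ⟨g ω, hgN ω⟩) ω) ⁻¹' s =
      ⋃ i, g ⁻¹' {(e i : ℕ)} ∩ m i ⁻¹' s := by
    ext ω
    simp only [Set.mem_preimage, Set.mem_iUnion, Set.mem_inter_iff, Set.mem_singleton_iff]
    constructor
    · exact fun h => ⟨e.symm ⟨g ω, hgN ω⟩, by simp, h⟩
    · rintro ⟨i, hi, h⟩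
      simpa [hi] using h
  rw [this]
  exact MeasurableSet.iUnion fun i => (hgm (measurableSet_singleton _)).inter (hm i hs)

end Selection

/-! ### Hoeffding's inequality -/

section Concentration

/-- Hoeffding's inequality for the empirical mean of a function with values in `[0, 1]`. -/
lemma measureReal_empirical_mean_le {α : Type*} [MeasurableSpace α] (D : Measure α)
    [IsProbabilityMeasure D] {n : ℕ} (hn : 0 < n) {g : α → ℝ} (hg : Measurable g)
    (hg01 : ∀ x, g x ∈ Set.Icc (0 : ℝ) 1) {η : ℝ} (hη : 0 ≤ η) :
    (Measure.pi fun _ : Fin n => D).real {c | η < |(n : ℝ)⁻¹ * ∑ i, g (c i) - ∫ x, g x ∂D|} ≤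
      2 * Real.exp (-2 * n * η ^ 2) := by
  set P := Measure.pi fun _ : Fin n => D with hP
  set Z : Fin n → (Fin n → α) → ℝ := fun i c => g (c i) - ∫ x, g x ∂D with hZ
  have hint : ∀ i, ∫ c, g (c i) ∂P = ∫ x, g x ∂D := fun i =>
    integral_comp_eval (μ := fun _ : Fin n => D) hg.aestronglyMeasurable
  have hind : iIndepFun Z P :=
    iIndepFun_pi (X := fun _ x => g x - ∫ x, g x ∂D) fun i => (hg.sub_const _).aemeasurable
  have hsub : ∀ i ∈ Finset.univ, HasSubgaussianMGF (Z i) ((‖(1 : ℝ) - 0‖₊ / 2) ^ 2) P := by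
    intro i _
    have h := hasSubgaussianMGF_of_mem_Icc (μ := P) (X := fun c => g (c i)) (a := 0) (b := 1)
      (hg.comp (measurable_pi_apply i)).aemeasurable (ae_of_all _ fun c => hg01 _)
    rwa [hint i] at h
  have hindn : iIndepFun (fun i => -Z i) P := hind.comp (fun _ x => -x) fun _ => measurable_neg
  have hn' : (0 : ℝ) < n := by exact_mod_cast hn
  have hexp : Real.exp (-(n * η) ^ 2 / (2 * ((∑ i : Fin n, (‖(1 : ℝ) - 0‖₊ / 2) ^ 2 : NNReal) : ℝ)))
      = Real.exp (-2 * n * η ^ 2) := by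
    congr 1
    simp
    field_simp
  have h1 := HasSubgaussianMGF.measure_sum_ge_le_of_iIndepFun hind hsub (ε := n * η) (by positivity)
  have h2 := HasSubgaussianMGF.measure_sum_ge_le_of_iIndepFun hindn (fun i hi => (hsub i hi).neg) (ε := n * η)
    (by positivity)
  rw [hexp] at h1 h2
  have hsub : {c : Fin n → α | η < |(n : ℝ)⁻¹ * ∑ i, g (c i) - ∫ x, g x ∂D|} ⊆
      {c | n * η ≤ ∑ i, Z i c} ∪ {c | n * η ≤ ∑ i, (-Z i) c} := by
    intro c hc
    have e : ∑ i, Z i c = n * ((n : ℝ)⁻¹ * ∑ i, g (c i) - ∫ x, g x ∂D) := by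
      simp [hZ, mul_sub, hn'.ne']
    simp only [Set.mem_union, Set.mem_ofPred_eq, Pi.neg_apply, Finset.sum_neg_distrib, e] at hc ⊢
    rcases lt_abs.1 hc with h | h
    · exact Or.inl (by gcongr)
    · right
      rw [← mul_neg]
      gcongr
  calc _ ≤ P.real ({c | n * η ≤ ∑ i, Z i c} ∪ {c | n * η ≤ ∑ i, (-Z i) c}) :=
        measureReal_mono hsub
    _ ≤ _ := measureReal_union_le _ _
    _ ≤ _ := by linarith

end Concentration

/-! ### The empirical distribution on words -/

section Empirical
variable {T d n : ℕ}

/-- The batches of a sample, continued by zeros. -/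
def extendSample (x : Sample T d) (s : ℕ) : Batch d := if h : s < T then x ⟨s, h⟩ else 0

/-- The empirical distribution of the rounded `j`-th layers of the samples `X`. -/
noncomputable def empirical (s : ℝ) (j : ℕ) (X : Fin n → ℕ → Batch d) (k : ℕ)
    (h : Fin k → Letter d) : ℝ :=
  (n : ℝ)⁻¹ * ∑ i, wordWeight (fun t => layerWeight s j (X i t)) k h

lemma empirical_nonneg (s : ℝ) (j : ℕ) (X : Fin n → ℕ → Batch d) (k : ℕ) (h : Fin k → Letter d) :
    0 ≤ empirical s j X k h :=
  mul_nonneg (by positivity) (Finset.sum_nonneg fun _ _ =>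
    wordWeight_nonneg (fun _ _ => layerWeight_nonneg _ _ _ _) _ _)

lemma sum_empirical {s : ℝ} (hs : 0 < s) (hn : 0 < n) (j : ℕ) (X : Fin n → ℕ → Batch d) (k : ℕ) :
    ∑ h, empirical s j X k h = 1 := by
  have hn' : (n : ℝ) ≠ 0 := by positivity
  simp_rw [empirical, ← Finset.mul_sum]
  rw [Finset.sum_comm]
  simp_rw [sum_wordWeight fun _ => sum_layerWeight hs j _]
  simp [hn']

lemma isConsistent_empirical {s : ℝ} (hs : 0 < s) (j : ℕ) (X : Fin n → ℕ → Batch d) :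
    IsConsistent T (empirical s j X) := by
  intro k hk h
  simp_rw [empirical, ← Finset.mul_sum]
  rw [Finset.sum_comm]
  congr 1
  exact Finset.sum_congr rfl fun i _ =>
    isConsistent_wordWeight (fun _ => sum_layerWeight hs j _) k hk h

lemma empirical_congr (s : ℝ) (j : ℕ) {X X' : Fin n → ℕ → Batch d} {k : ℕ}
    (hX : ∀ i, ∀ t < k, X i t = X' i t) (h : Fin k → Letter d) :
    empirical s j X k h = empirical s j X' k h := by
  unfold empirical
  congr 1
  exact Finset.sum_congr rfl fun i _ => wordWeight_congr (fun t ht => by rw [hX i t ht]) h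

lemma measurable_empirical (s : ℝ) (j : ℕ) (k : ℕ) (h : Fin k → Letter d) :
    Measurable fun X : Fin n → ℕ → Batch d => empirical s j X k h := by
  unfold empirical wordWeight
  refine (Finset.measurable_sum _ fun i _ => Finset.measurable_prod _ fun t _ => ?_).const_mul _
  exact (measurable_layerWeight s j (h t)).comp
    ((measurable_pi_apply _).comp (measurable_pi_apply i))

lemma measurable_condMean_empirical (r s : ℝ) (j t : ℕ) (h : Fin t → Letter d) :
    Measurable fun X : Fin n → ℕ → Batch d => condMean r letterVal (empirical s j X) t h := by
  refine (measurable_clip r).comp ((measurable_empirical s j t h).inv.smul ?_)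
  exact Finset.measurable_sum _ fun y _ =>
    (measurable_empirical s j (t + 1) (addLetter h y)).smul_const _

lemma condMean_empirical_congr (r s : ℝ) (j : ℕ) {X X' : Fin n → ℕ → Batch d} {t : ℕ}
    (hX : ∀ i, ∀ u ≤ t, X i u = X' i u) (h : Fin t → Letter d) :
    condMean r letterVal (empirical s j X) t h = condMean r letterVal (empirical s j X') t h := by
  unfold condMean
  rw [empirical_congr s j fun i u hu => hX i u hu.le]
  simp_rw [empirical_congr (k := t + 1) s j fun i u hu => hX i u (Nat.lt_succ_iff.1 hu)]

lemma IsMedoid.congr {r s : ℝ} {j : ℕ} {X X' : Fin n → ℕ → Batch d} {t : ℕ}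
    (hX : ∀ i, ∀ u ≤ t, X i u = X' i u) {h₀ : Fin t → Letter d}
    (h : IsMedoid r letterVal (empirical s j X) t h₀) :
    IsMedoid r letterVal (empirical s j X') t h₀ := by
  intro h'
  have := h h'
  simp_rw [condMean_empirical_congr r s j hX, empirical_congr (k := t) s j fun i u hu => hX i u hu.le]
    at this
  exact this

/-- A measurable choice of a medoid of the conditional means. -/
lemma exists_measurable_medoid (n d : ℕ) (r s : ℝ) (j t : ℕ) :
    ∃ v : (Fin n → ℕ → Batch d) → Batch d, Measurable v ∧
      ∀ X, ∃ h₀, v X = condMean r letterVal (empirical s j X) t h₀ ∧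
        IsMedoid r letterVal (empirical s j X) t h₀ :=
  exists_measurable_argmin (ι := Fin t → Letter d)
    (f := fun h' X => ∑ h, empirical s j X t h * ‖condMean r letterVal (empirical s j X) t h -
      condMean r letterVal (empirical s j X) t h'‖)
    (fun h' => Finset.measurable_sum _ fun h _ => (measurable_empirical s j t h).mul
      ((measurable_condMean_empirical r s j t h).sub
        (measurable_condMean_empirical r s j t h')).norm)
    (fun h => measurable_condMean_empirical r s j t h)

/-- The empirical distribution is symmetric in the samples, so `σ` is harmless. Each replaced sample
exchanges one probability vector for another, a change of at most `2 / n` in ℓ¹. -/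
lemma sum_abs_empirical_sub_le {s ε : ℝ} (hs : 0 < s) (hn : 0 < n) (j : ℕ) {c x : Data n T d}
    (hx : IsCorruptedVersion ε c x) (k : ℕ) :
    ∑ z, |empirical s j (fun i => extendSample (x i)) k z -
      empirical s j (fun i => extendSample (c i)) k z| ≤ 2 * ε := by
  classical
  obtain ⟨σ, hσ⟩ := hx
  have hn' : (0 : ℝ) < n := by exact_mod_cast hn
  set W : Sample T d → (Fin k → Letter d) → ℝ :=
    fun y => wordWeight (fun t => layerWeight s j (extendSample y t)) k with hW
  have hW0 : ∀ y z, 0 ≤ W y z := fun y z =>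
    wordWeight_nonneg (fun _ _ => layerWeight_nonneg _ _ _ _) _ _
  have hW1 : ∀ y, ∑ z, W y z = 1 := fun y => sum_wordWeight (fun _ => sum_layerWeight hs j _) k
  have h1 : ∀ z, empirical s j (fun i => extendSample (x i)) k z -
      empirical s j (fun i => extendSample (c i)) k z =
      (n : ℝ)⁻¹ * ∑ i, (W (x i) z - W (c (σ i)) z) := by
    intro z
    rw [Finset.sum_sub_distrib, Equiv.sum_comp σ fun i => W (c i) z, mul_sub]
    rfl
  have h2 : ∀ i, ∑ z, |W (x i) z - W (c (σ i)) z| ≤ if x i ≠ c (σ i) then 2 else 0 := by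
    intro i
    split_ifs with h
    · calc ∑ z, |W (x i) z - W (c (σ i)) z| ≤ ∑ z, (W (x i) z + W (c (σ i)) z) :=
            Finset.sum_le_sum fun z _ => (abs_sub _ _).trans
              (by rw [abs_of_nonneg (hW0 _ _), abs_of_nonneg (hW0 _ _)])
        _ = 2 := by rw [Finset.sum_add_distrib, hW1, hW1]; norm_num
    · rw [not_not.1 h]; simp
  have h3 : ∑ i, (if x i ≠ c (σ i) then (2 : ℝ) else 0) ≤ 2 * (ε * n) := by
    rw [← Finset.sum_filter, Finset.sum_const, nsmul_eq_mul, mul_comm]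
    gcongr
    rwa [Set.ncard_eq_toFinset_card', Set.toFinset_ofPred] at hσ
  simp_rw [h1, abs_mul, abs_of_nonneg (inv_nonneg.2 hn'.le), ← Finset.mul_sum]
  calc (n : ℝ)⁻¹ * ∑ z, |∑ i, (W (x i) z - W (c (σ i)) z)|
      ≤ (n : ℝ)⁻¹ * ∑ z, ∑ i, |W (x i) z - W (c (σ i)) z| := by
        gcongr
        exact Finset.abs_sum_le_sum_abs _ _
    _ = (n : ℝ)⁻¹ * ∑ i, ∑ z, |W (x i) z - W (c (σ i)) z| := by rw [Finset.sum_comm]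
    _ ≤ (n : ℝ)⁻¹ * (2 * (ε * n)) := by
        gcongr
        exact (Finset.sum_le_sum fun i _ => h2 i).trans h3
    _ = 2 * ε := by field_simp

end Empirical

/-! ### The estimator and its error on typical data -/

section LayeredEstimator
variable {T d n : ℕ}

lemma l2Dist_eq_norm (u v : Sample T d) :
    l2Dist u v = ‖(WithLp.toLp 2 u - WithLp.toLp 2 v : PiLp 2 fun _ : Fin T => Batch d)‖ := by
  rw [PiLp.norm_eq_of_L2, l2Dist]
  rfl

lemma l2Dist_triangle (u v w : Sample T d) : l2Dist u w ≤ l2Dist u v + l2Dist v w := by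
  simp_rw [l2Dist_eq_norm]
  exact norm_sub_le_norm_sub_add_norm_sub _ _ _

lemma l2Dist_sum_smul_le {J : ℕ} {s : ℝ} (hs : 0 ≤ s) (u v : ℕ → Sample T d) :
    l2Dist (fun t => ∑ j ∈ Finset.range J, s • u j t) (fun t => ∑ j ∈ Finset.range J, s • v j t) ≤
      ∑ j ∈ Finset.range J, s * l2Dist (u j) (v j) := by
  have h : (WithLp.toLp 2 (fun t => ∑ j ∈ Finset.range J, s • u j t) -
      WithLp.toLp 2 (fun t => ∑ j ∈ Finset.range J, s • v j t) : PiLp 2 fun _ : Fin T => Batch d) =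
      ∑ j ∈ Finset.range J, s • (WithLp.toLp 2 (u j) - WithLp.toLp 2 (v j)) := by
    ext t : 1
    simp [smul_sub, Finset.sum_sub_distrib]
  rw [l2Dist_eq_norm, h]
  refine (norm_sum_le _ _).trans (Finset.sum_le_sum fun j _ => ?_)
  rw [norm_smul, Real.norm_of_nonneg hs, l2Dist_eq_norm]

lemma l2Dist_le_of_forall_le {u v : Sample T d} {b : ℝ} (hb : 0 ≤ b)
    (h : ∀ t, ‖u t - v t‖ ≤ b / Real.sqrt T) : l2Dist u v ≤ b := by
  rw [l2Dist, Real.sqrt_le_iff]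
  refine ⟨hb, ?_⟩
  calc ∑ t, ‖u t - v t‖ ^ 2 ≤ ∑ _t : Fin T, (b / Real.sqrt T) ^ 2 := by
        gcongr with t
        exact h t
    _ = T * (b ^ 2 / T) := by simp [div_pow]
    _ ≤ b ^ 2 := by
        rcases T.eq_zero_or_pos with rfl | hT
        · simpa using sq_nonneg b
        · exact (mul_div_cancel₀ _ (by positivity)).le

/-- The law of the letter of the `j`-th layer in each round, for the product of the `X t`. -/
noncomputable def letterLaw (s : ℝ) (j : ℕ) (X : Fin T → Measure (Batch d)) (t : ℕ)
    (y : Letter d) : ℝ :=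
  if h : t < T then ∫ x, layerWeight s j x y ∂X ⟨t, h⟩ else layerWeight s j 0 y

lemma letterLaw_nonneg (s : ℝ) (j : ℕ) (X : Fin T → Measure (Batch d)) (t : ℕ) (y : Letter d) :
    0 ≤ letterLaw s j X t y := by
  unfold letterLaw
  split_ifs
  · exact integral_nonneg fun x => layerWeight_nonneg s j x y
  · exact layerWeight_nonneg s j 0 y

lemma sum_letterLaw {s : ℝ} (hs : 0 < s) (j : ℕ) (X : Fin T → Measure (Batch d))
    [∀ t, IsProbabilityMeasure (X t)] (t : ℕ) : ∑ y, letterLaw s j X t y = 1 := by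
  unfold letterLaw
  split_ifs
  · exact sum_integral_layerWeight hs j _
  · exact sum_layerWeight hs j 0

/-- Independence of the rounds: the expected empirical distribution is a product law. -/
lemma integral_wordWeight (s : ℝ) (j : ℕ) (X : Fin T → Measure (Batch d))
    [∀ t, IsProbabilityMeasure (X t)] (z : Fin T → Letter d) :
    ∫ x, wordWeight (fun t => layerWeight s j (extendSample x t)) T z ∂Measure.pi X =
      wordWeight (letterLaw s j X) T z := by
  simp only [wordWeight, extendSample, letterLaw, Fin.is_lt, dite_true, Fin.eta]
  exact integral_fintype_prod_eq_prod fun t x => layerWeight s j x (z t)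

lemma measurable_extendSample (t : ℕ) : Measurable fun x : Sample T d => extendSample x t := by
  unfold extendSample
  split_ifs
  · exact measurable_pi_apply _
  · exact measurable_const

/-- The data sets whose empirical distributions on the first `J` layers are close to the truth. -/
def typicalData (n : ℕ) (s ε : ℝ) (J : ℕ) (X : Fin T → Measure (Batch d)) : Set (Data n T d) :=
  {c | ∀ j < J, ∀ z : Fin T → Letter d,
    |empirical s j (fun i => extendSample (c i)) T z - wordWeight (letterLaw s j X) T z| ≤
      ε / Fintype.card (Fin T → Letter d)}

lemma measurable_empirical_extendSample (s : ℝ) (j k : ℕ) (z : Fin k → Letter d) :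
    Measurable fun c : Data n T d => empirical s j (fun i => extendSample (c i)) k z := by
  refine (measurable_empirical s j k z).comp ?_
  refine measurable_pi_lambda _ fun i => measurable_pi_lambda _ fun t => ?_
  exact (measurable_extendSample t).comp (measurable_pi_apply i)

lemma measurableSet_typicalData (s ε : ℝ) (J : ℕ) (X : Fin T → Measure (Batch d)) :
    MeasurableSet (typicalData n s ε J X) := by
  simp only [typicalData, Set.ofPred_forall]
  refine MeasurableSet.iInter fun j => MeasurableSet.iInter fun _ => MeasurableSet.iInter fun z => ?_
  exact measurableSet_le ((measurable_empirical_extendSample s j T z).sub_const _).abs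
    measurable_const

lemma measureReal_compl_typicalData_le {s ε : ℝ} (hs : 0 < s) (hε : 0 ≤ ε) (hn : 0 < n) (J : ℕ)
    (X : Fin T → Measure (Batch d)) [∀ t, IsProbabilityMeasure (X t)] :
    (Measure.pi fun _ : Fin n => Measure.pi X).real (typicalData n s ε J X)ᶜ ≤
      J * (Fintype.card (Fin T → Letter d) * (2 * Real.exp
        (-2 * n * (ε / Fintype.card (Fin T → Letter d)) ^ 2))) := by
  set P := Measure.pi fun _ : Fin n => Measure.pi X with hP
  set N := Fintype.card (Fin T → Letter d) with hN
  have hsub : (typicalData n s ε J X)ᶜ ⊆ ⋃ j ∈ Finset.range J,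
      ⋃ z ∈ (Finset.univ : Finset (Fin T → Letter d)),
      {c | ε / N < |empirical s j (fun i => extendSample (c i)) T z -
        wordWeight (letterLaw s j X) T z|} := by
    intro c hc
    simp only [typicalData, Set.mem_compl_iff, Set.mem_ofPred_eq, not_forall, not_le] at hc
    obtain ⟨j, hj, z, h⟩ := hc
    simp only [Set.mem_iUnion, Finset.mem_range]
    exact ⟨j, hj, z, Finset.mem_univ z, h⟩
  refine (measureReal_mono hsub (measure_ne_top _ _)).trans ?_
  refine (measureReal_biUnion_finset_le _ _).trans ?_
  rw [← Finset.card_range J, ← nsmul_eq_mul, Finset.card_range]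
  conv_rhs => rw [← Finset.card_range J]
  refine Finset.sum_le_card_nsmul _ _ _ fun j _ => ?_
  refine (measureReal_biUnion_finset_le _ _).trans ?_
  rw [← nsmul_eq_mul, hN, ← Finset.card_univ]
  refine Finset.sum_le_card_nsmul _ _ _ fun z _ => ?_
  have h := measureReal_empirical_mean_le (Measure.pi X) hn
    (g := fun x => wordWeight (fun t => layerWeight s j (extendSample x t)) T z)
    (Finset.measurable_prod _ fun t _ =>
      (measurable_layerWeight s j (z t)).comp (measurable_extendSample _))
    (fun x => ⟨wordWeight_nonneg (fun _ _ => layerWeight_nonneg _ _ _ _) _ _,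
      Finset.prod_le_one (fun _ _ => layerWeight_nonneg _ _ _ _)
        fun _ _ => layerWeight_le_one hs _ _ _⟩) (η := ε / N) (by positivity)
  rw [integral_wordWeight] at h
  exact h

/-- The batches seen until round `t`, continued by zeros. -/
def extendPrefix (t : Fin T) (z : Fin n → Set.Iic t → Batch d) (i : Fin n) (u : ℕ) : Batch d :=
  if hu : u ≤ t then z i ⟨⟨u, hu.trans_lt t.2⟩, hu⟩ else 0

lemma measurable_extendPrefix (t : Fin T) :
    Measurable (extendPrefix t : (Fin n → Set.Iic t → Batch d) → _) := by
  refine measurable_pi_lambda _ fun i => measurable_pi_lambda _ fun u => ?_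
  unfold extendPrefix
  split_ifs
  · exact (measurable_pi_apply _).comp (measurable_pi_apply i)
  · exact measurable_const

lemma extendPrefix_eq (x : Data n T d) {t : Fin T} {u : ℕ} (hu : u ≤ t) (i : Fin n) :
    extendPrefix t (fun i s => x i s) i u = extendSample (x i) u := by
  simp [extendPrefix, extendSample, hu, hu.trans_lt t.2]

/-- A measurably chosen medoid of the conditional means of the `j`-th layer. -/
noncomputable def layerMedoid (n d : ℕ) (r s : ℝ) (j t : ℕ) :
    (Fin n → ℕ → Batch d) → Batch d :=
  (exists_measurable_medoid n d r s j t).choose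

lemma measurable_layerMedoid (r s : ℝ) (j t : ℕ) : Measurable (layerMedoid n d r s j t) :=
  (exists_measurable_medoid n d r s j t).choose_spec.1

lemma layerMedoid_spec (r s : ℝ) (j t : ℕ) (X : Fin n → ℕ → Batch d) :
    ∃ h₀, layerMedoid n d r s j t X = condMean r letterVal (empirical s j X) t h₀ ∧
      IsMedoid r letterVal (empirical s j X) t h₀ :=
  (exists_measurable_medoid n d r s j t).choose_spec.2 X

/-- The deterministic estimator that adds up the medoids of `J` layers of width `s`. -/
noncomputable def layeredEstimator (n T d : ℕ) (s : ℝ) (J : ℕ) (f : ℕ → ℝ) :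
    OnlineEstimator n T d where
  Seed := Unit
  seedLaw := Measure.dirac ()
  estimate t _ z := ∑ j ∈ Finset.range J, s • layerMedoid n d (2 * f j) s j t (extendPrefix t z)
  measurable_estimate t := by
    refine Finset.measurable_sum _ fun j _ => Measurable.const_smul ?_ s
    exact (measurable_layerMedoid _ s j t).comp ((measurable_extendPrefix t).comp measurable_snd)

/-- The online constraint is respected: the conditional means of round `t` involve only words of
length at most `t + 1`, so the prefix determines the same medoid problem as the full data. -/
lemma exists_layerMedoid_eq (r s : ℝ) (j : ℕ) (t : Fin T) (x : Data n T d) :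
    ∃ h₀ : Fin t → Letter d, layerMedoid n d r s j t (extendPrefix t fun i s => x i s) =
        condMean r letterVal (empirical s j fun i => extendSample (x i)) t h₀ ∧
      IsMedoid r letterVal (empirical s j fun i => extendSample (x i)) t h₀ := by
  obtain ⟨h₀, h1, h2⟩ := layerMedoid_spec r s j t (extendPrefix t fun i s => x i s)
  have hX : ∀ i, ∀ u ≤ (t : ℕ), extendPrefix t (fun i s => x i s) i u = extendSample (x i) u :=
    fun i u hu => extendPrefix_eq x hu i
  exact ⟨h₀, h1.trans (condMean_empirical_congr r s j hX h₀), h2.congr hX⟩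

lemma l2Dist_layerMedoid_le {s ε f : ℝ} {j J : ℕ} (hs : 0 < s) (hε : 0 < ε) (hε1 : ε ≤ 1 / 96)
    (hn : 0 < n) (hf : 0 ≤ f) (X : Fin T → Measure (Batch d)) [∀ t, IsProbabilityMeasure (X t)]
    (hX : ∀ t, X t {y | j * s ≤ ‖y‖} ≤ ENNReal.ofReal f) {c x : Data n T d} (hj : j < J)
    (hc : c ∈ typicalData n s ε J X) (hx : IsCorruptedVersion ε c x) :
    l2Dist (fun t => layerMedoid n d (2 * f) s j t (extendPrefix t fun i s => x i s))
      (fun t => ∫ y, layer s j y ∂X t) ≤ 10 ^ 5 * min ε (Real.sqrt (ε * f)) := by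
  set p := empirical s j fun i => extendSample (x i) with hp
  set N := Fintype.card (Fin T → Letter d) with hN
  have hN0 : (0 : ℝ) < N := by exact_mod_cast Fintype.card_pos
  choose h₀ hv hmed using fun t : Fin T => exists_layerMedoid_eq (2 * f) s j t x
  -- The values from `T` on are fillers.
  set h₁ : ∀ t : ℕ, Fin t → Letter d := fun t =>
    if ht : t < T then h₀ ⟨t, ht⟩ else fun _ => Classical.arbitrary _ with hh₁
  have hh : ∀ t : Fin T, h₁ t = h₀ t := fun t => by simp [hh₁]
  have hstat : ∑ z, |empirical s j (fun i => extendSample (c i)) T z -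
      wordWeight (letterLaw s j X) T z| ≤ ε := by
    calc _ ≤ ∑ _z : Fin T → Letter d, ε / N := Finset.sum_le_sum fun z _ => hc j hj z
      _ = ε := by
        rw [Finset.sum_const, nsmul_eq_mul, Finset.card_univ, ← hN]
        field_simp
  -- Corruption contributes `2 * ε` and sampling `ε`. With `δ = 3 * ε`, the condition `δ ≤ 1 / 32`
  -- is `ε ≤ 1 / 96`.
  have htv : ∑ z, |p T z - wordWeight (letterLaw s j X) T z| ≤ 3 * ε := by
    calc _ ≤ ∑ z, (|p T z - empirical s j (fun i => extendSample (c i)) T z| +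
          |empirical s j (fun i => extendSample (c i)) T z -
            wordWeight (letterLaw s j X) T z|) :=
          Finset.sum_le_sum fun z _ => abs_sub_le _ _ _
      _ ≤ 2 * ε + ε := by
          rw [Finset.sum_add_distrib]
          exact add_le_add (sum_abs_empirical_sub_le hs hn j hx T) hstat
      _ = _ := by ring
  have hmain := sum_norm_medoid_sub_sq_le (T := T) (q := letterLaw s j X) (p := p)
    (val := letterVal) (δ := 3 * ε) (f := f) (h₀ := h₁) (by positivity) (by linarith)
    (letterLaw_nonneg s j X) (sum_letterLaw hs j X) norm_letterVal_le (nonzeroLetters d)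
    (fun y hy => letterVal_eq_zero hy) hf
    (fun t ht => by
      simp only [letterLaw, ht, dite_true]
      exact sum_nonzero_integral_layerWeight_le hs j _ hf (hX _))
    (isConsistent_empirical hs j _) (empirical_nonneg s j _) (sum_empirical hs hn j _ T) htv
    (fun t ht => by
      have := hmed ⟨t, ht⟩
      rwa [← hh ⟨t, ht⟩] at this)
  rw [Finset.sum_range] at hmain
  rw [l2Dist]
  have hG : 0 ≤ min ε (Real.sqrt (ε * f)) := le_min hε.le (Real.sqrt_nonneg _)
  refine Real.sqrt_le_iff.2 ⟨by positivity, ?_⟩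
  have e1 : ∀ t : Fin T,
      ‖layerMedoid n d (2 * f) s j t (extendPrefix t fun i s => x i s) - ∫ y, layer s j y ∂X t‖ =
      ‖condMean (2 * f) letterVal p t (h₁ t) - ∑ y, letterLaw s j X t y • letterVal y‖ := by
    intro t
    rw [hv t, hh t]
    simp only [letterLaw, Fin.is_lt, dite_true, Fin.eta]
    rw [sum_integral_layerWeight_smul hs j (X t)]
  simp_rw [e1]
  refine hmain.trans ?_
  have e2 : min ε (Real.sqrt (ε * f)) ^ 2 = min (ε ^ 2) (ε * f) := by
    rcases le_total ε (Real.sqrt (ε * f)) with h | h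
    · rw [min_eq_left h, min_eq_left (by rwa [Real.le_sqrt' hε] at h)]
    · rw [min_eq_right h, Real.sq_sqrt (by positivity),
        min_eq_right (by rwa [Real.sqrt_le_left hε.le] at h)]
  -- The constant works because `10 ^ 9 * 9 ≤ (10 ^ 5) ^ 2`.
  rw [mul_pow (10 ^ 5 : ℝ), e2]
  have e3 : min ((3 * ε) ^ 2) (3 * ε * f) ≤ 9 * min (ε ^ 2) (ε * f) := by
    rw [mul_min_of_nonneg _ _ (by norm_num : (0 : ℝ) ≤ 9)]
    have : 0 ≤ ε * f := by positivity
    exact min_le_min (by ring_nf; rfl) (by linarith)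
  have e4 : 0 ≤ min (ε ^ 2) (ε * f) := le_min (by positivity) (by positivity)
  linarith

lemma l2Dist_layeredEstimator_le {s ε : ℝ} {J : ℕ} {f : ℕ → ℝ} (hs : 0 < s) (hε : 0 < ε)
    (hε1 : ε ≤ 1 / 96) (hn : 0 < n) (hf : ∀ j, 0 ≤ f j) (X : Fin T → Measure (Batch d))
    [∀ t, IsProbabilityMeasure (X t)]
    (hX : ∀ t, ∀ j : ℕ, X t {y | j * s ≤ ‖y‖} ≤ ENNReal.ofReal (f j)) {c x : Data n T d}
    (hc : c ∈ typicalData n s ε J X) (hx : IsCorruptedVersion ε c x) :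
    l2Dist ((layeredEstimator n T d s J f).run x ()) (fun t => ∫ y, clip (J * s) y ∂X t) ≤
      10 ^ 5 * ∑ j ∈ Finset.range J, s * min ε (Real.sqrt (ε * f j)) := by
  have h1 : (fun t => ∫ y, clip (J * s) y ∂X t) =
      fun t => ∑ j ∈ Finset.range J, s • ∫ y, layer s j y ∂X t := by
    ext1 t
    simp_rw [← sum_smul_layer hs, ← integral_smul]
    refine integral_finsetSum _ fun j _ => Integrable.smul s ?_
    exact Integrable.of_bound (measurable_layer s j).aestronglyMeasurable 1
      (ae_of_all _ fun y => norm_layer_le hs j y)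
  rw [h1, Finset.mul_sum]
  refine (l2Dist_sum_smul_le hs.le _ _).trans (Finset.sum_le_sum fun j hj => ?_)
  rw [mul_left_comm]
  exact mul_le_mul_of_nonneg_left (l2Dist_layerMedoid_le hs hε hε1 hn (hf j) X (fun t => hX t j)
    (Finset.mem_range.1 hj) hc hx) hs.le

end LayeredEstimator

/-! ### Integrals of the tail function, `Q` and `L` -/

section TailFunction
variable {F : ℝ → ℝ} {ε : ℝ}

lemma rateIntegrand_nonneg (hε : 0 < ε) (q : ℝ) : 0 ≤ rateIntegrand F ε q :=
  le_min hε.le (Real.sqrt_nonneg _)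

lemma rateQ_nonneg (hε : 0 < ε) : 0 ≤ rateQ F ε :=
  integral_nonneg fun q => rateIntegrand_nonneg hε q

lemma cutoffL_nonneg {T : ℕ} : 0 ≤ cutoffL F ε T := Real.sInf_nonneg fun _ h => h.1

lemma IsTailFunction.antitoneOn_rateIntegrand (hF : IsTailFunction F) (hε : 0 < ε) :
    AntitoneOn (rateIntegrand F ε) (Set.Ici 0) := fun _ ha _ hb hab =>
  min_le_min le_rfl (Real.sqrt_le_sqrt (mul_le_mul_of_nonneg_left (hF.antitoneOn ha hb hab) hε.le))

/-- Since `F q` and `ε * F q` are at most `1`, `ε * F q` is below both `ε` and its own square root.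
-/
lemma IsTailFunction.le_rateIntegrand_div (hF : IsTailFunction F) (hε : 0 < ε) (hε1 : ε ≤ 1)
    {q : ℝ} (hq : 0 ≤ q) : F q ≤ ε⁻¹ * rateIntegrand F ε q := by
  obtain ⟨h0, h1⟩ := hF.mem_Icc q hq
  rw [le_inv_mul_iff₀ hε]
  refine le_min (by nlinarith) (Real.le_sqrt_of_sq_le ?_)
  calc (ε * F q) ^ 2 = ε * F q * (ε * F q) := sq _
    _ ≤ ε * F q * 1 := by
        gcongr
        nlinarith
    _ = _ := mul_one _

lemma IsTailFunction.integrableOn (hF : IsTailFunction F) (hε : 0 < ε) (hε1 : ε ≤ 1)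
    (hint : IntegrableOn (rateIntegrand F ε) (Set.Ioi 0)) : IntegrableOn F (Set.Ioi 0) := by
  refine (hint.const_mul ε⁻¹).mono' ?_ ?_
  · exact (aemeasurable_restrict_of_antitoneOn measurableSet_Ioi
      (hF.antitoneOn.mono Set.Ioi_subset_Ici_self)).aestronglyMeasurable
  · refine (ae_restrict_mem measurableSet_Ioi).mono fun q hq => ?_
    rw [Real.norm_of_nonneg (hF.mem_Icc q (le_of_lt hq)).1]
    exact hF.le_rateIntegrand_div hε hε1 (le_of_lt hq)

lemma IsTailFunction.integral_Ioi_anti (hF : IsTailFunction F)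
    (hint : IntegrableOn F (Set.Ioi 0)) {z w : ℝ} (hz : 0 ≤ z) (hzw : z ≤ w) :
    ∫ q in Set.Ioi w, F q ≤ ∫ q in Set.Ioi z, F q := by
  refine setIntegral_mono_set (hint.mono_set (Set.Ioi_subset_Ioi hz)) ?_
    (Set.Ioi_subset_Ioi hzw).eventuallyLE
  exact (ae_restrict_mem measurableSet_Ioi).mono fun q hq =>
    (hF.mem_Icc q (hz.trans (le_of_lt hq))).1

lemma IsTailFunction.integral_le_of_rateQ (hF : IsTailFunction F) (hε : 0 < ε) (hε1 : ε ≤ 1)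
    (hint : IntegrableOn (rateIntegrand F ε) (Set.Ioi 0)) :
    ∫ q in Set.Ioi (0 : ℝ), F q ≤ ε⁻¹ * rateQ F ε := by
  rw [rateQ, ← integral_const_mul]
  exact setIntegral_mono_on (hF.integrableOn hε hε1 hint) (hint.const_mul _) measurableSet_Ioi
    fun q hq => hF.le_rateIntegrand_div hε hε1 (le_of_lt hq)

lemma tendsto_integral_Ioi_atTop (hint : IntegrableOn F (Set.Ioi 0)) :
    Filter.Tendsto (fun z => ∫ q in Set.Ioi z, F q) Filter.atTop (nhds 0) := by
  have h := (intervalIntegral_tendsto_integral_Ioi 0 hint Filter.tendsto_id).const_sub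
    (∫ q in Set.Ioi (0 : ℝ), F q)
  rw [sub_self] at h
  refine h.congr' ((Filter.eventually_ge_atTop 0).mono fun z hz => ?_)
  have h2 := setIntegral_union (f := F) (μ := volume) (Set.Ioc_disjoint_Ioi (le_refl z))
    measurableSet_Ioi (hint.mono_set Set.Ioc_subset_Ioi_self)
    (hint.mono_set (Set.Ioi_subset_Ioi hz))
  rw [Set.Ioc_union_Ioi_eq_Ioi hz] at h2
  simp only [id, intervalIntegral.integral_of_le hz]
  linarith

lemma cutoffL_eq_zero_of_rateQ (hF : IsTailFunction F) (hε : 0 < ε) (hε1 : ε ≤ 1)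
    (hint : IntegrableOn (rateIntegrand F ε) (Set.Ioi 0)) (T : ℕ) (hQ : rateQ F ε = 0) :
    cutoffL F ε T = 0 := by
  refine le_antisymm (csInf_le ⟨0, fun _ h => h.1⟩ ⟨le_rfl, ?_⟩) cutoffL_nonneg
  have := hF.integral_le_of_rateQ hε hε1 hint
  rw [hQ, mul_zero] at this
  simpa [hQ] using this

lemma integral_Ioi_le_of_cutoffL_lt (hF : IsTailFunction F) (hε : 0 < ε) (hε1 : ε ≤ 1)
    (hint : IntegrableOn (rateIntegrand F ε) (Set.Ioi 0)) {T : ℕ} (hT : 0 < T) {z : ℝ}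
    (hz : cutoffL F ε T < z) : ∫ q in Set.Ioi z, F q ≤ rateQ F ε / Real.sqrt T := by
  have hFi := hF.integrableOn hε hε1 hint
  have hne : {z : ℝ | 0 ≤ z ∧ ∫ q in Set.Ioi z, F q ≤ rateQ F ε / Real.sqrt T}.Nonempty := by
    rcases (rateQ_nonneg (F := F) hε).eq_or_lt with hQ | hQ
    · refine ⟨0, le_rfl, ?_⟩
      have := hF.integral_le_of_rateQ hε hε1 hint
      rw [← hQ, mul_zero] at this
      simpa [← hQ] using this
    · have hpos : 0 < rateQ F ε / Real.sqrt T := by positivity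
      obtain ⟨w, hw1, hw2⟩ := (((tendsto_integral_Ioi_atTop hFi).eventually_le_const hpos).and
        (Filter.eventually_ge_atTop 0)).exists
      exact ⟨w, hw2, hw1⟩
  obtain ⟨w, ⟨hw0, hw⟩, hwz⟩ := exists_lt_of_csInf_lt hne hz
  exact (hF.integral_Ioi_anti hFi hw0 hwz.le).trans hw

/-- For a decreasing function the right-endpoint Riemann sum is below the integral; the extra term
at `0` is at most `s * ε`. -/
lemma sum_rateIntegrand_le (hF : IsTailFunction F) (hε : 0 < ε)
    (hint : IntegrableOn (rateIntegrand F ε) (Set.Ioi 0)) {s : ℝ} (hs : 0 < s) (J : ℕ) :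
    ∑ j ∈ Finset.range J, s * rateIntegrand F ε (j * s) ≤ s * ε + rateQ F ε := by
  set G := rateIntegrand F ε with hG
  have hG0 : ∀ q, 0 ≤ G q := rateIntegrand_nonneg hε
  have h1 : ∑ j ∈ Finset.range J, s * G (j * s) ≤ ∑ j ∈ Finset.range (J + 1), s * G (j * s) :=
    Finset.sum_le_sum_of_subset_of_nonneg (Finset.range_mono (Nat.le_succ J))
      fun j _ _ => mul_nonneg hs.le (hG0 _)
  have hanti : AntitoneOn (fun u => G (u * s)) (Set.Icc (0 : ℝ) (0 + J)) := fun a ha b hb hab =>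
    hF.antitoneOn_rateIntegrand hε (mul_nonneg ha.1 hs.le) (mul_nonneg hb.1 hs.le) (by gcongr)
  have h2 := hanti.sum_le_integral
  rw [intervalIntegral.integral_comp_mul_right _ hs.ne', zero_mul, zero_add, smul_eq_mul,
    intervalIntegral.integral_of_le (by positivity)] at h2
  have h3 : ∫ q in Set.Ioc 0 (J * s), G q ≤ rateQ F ε :=
    setIntegral_mono_set hint (ae_of_all _ hG0) Set.Ioc_subset_Ioi_self.eventuallyLE
  rw [le_inv_mul_iff₀ hs, Finset.mul_sum] at h2
  rw [Finset.sum_range_succ'] at h1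
  have h4 : G ((0 : ℕ) * s) ≤ ε := min_le_left _ _
  have h5 := mul_le_mul_of_nonneg_left h4 hs.le
  simp only [zero_add] at h2
  linarith

end TailFunction

/-! ### The bias of truncation -/

section TruncationBias
variable {F : ℝ → ℝ} {d : ℕ} {μ : Measure (Batch d)} [IsProbabilityMeasure μ]

omit [IsProbabilityMeasure μ] in
lemma lintegral_norm_sub_min_le (hF : IsTailFunction F) (hint : IntegrableOn F (Set.Ioi 0))
    (hμ : ∀ q, 0 ≤ q → μ {y | q ≤ ‖y‖} ≤ ENNReal.ofReal (F q)) {z : ℝ} (hz : 0 ≤ z) :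
    ∫⁻ y, ENNReal.ofReal (‖y‖ - min ‖y‖ z) ∂μ ≤ ENNReal.ofReal (∫ q in Set.Ioi z, F q) := by
  rw [lintegral_eq_lintegral_meas_le μ (ae_of_all _ fun y => sub_nonneg.2 (min_le_left _ _))
    (by fun_prop)]
  have hpre : (fun q : ℝ => z + q) ⁻¹' Set.Ioi z = Set.Ioi 0 := by
    ext q; simp
  calc ∫⁻ q in Set.Ioi 0, μ {y | q ≤ ‖y‖ - min ‖y‖ z}
      ≤ ∫⁻ q in Set.Ioi 0, ENNReal.ofReal (F (z + q)) := by
        refine setLIntegral_mono' measurableSet_Ioi fun q hq => ?_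
        have hq : 0 < q := hq
        refine (measure_mono fun y hy => ?_).trans (hμ (z + q) (by positivity))
        have hy : q ≤ ‖y‖ - min ‖y‖ z := hy
        change z + q ≤ ‖y‖
        rcases le_total ‖y‖ z with h | h
        · rw [min_eq_left h] at hy; linarith
        · rw [min_eq_right h] at hy; linarith
    _ = ∫⁻ q in Set.Ioi z, ENNReal.ofReal (F q) := by
        rw [← hpre]
        exact (measurePreserving_add_left volume z).setLIntegral_comp_preimage_emb
          (measurableEmbedding_addLeft z) (fun q => ENNReal.ofReal (F q)) _
    _ = ENNReal.ofReal (∫ q in Set.Ioi z, F q) := by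
        rw [ofReal_integral_eq_lintegral_ofReal (hint.mono_set (Set.Ioi_subset_Ioi hz))]
        exact (ae_restrict_mem measurableSet_Ioi).mono fun q hq =>
          (hF.mem_Icc q (hz.trans (le_of_lt hq))).1

omit [IsProbabilityMeasure μ] in
lemma integrable_id_of_tail (hF : IsTailFunction F) (hint : IntegrableOn F (Set.Ioi 0))
    (hμ : ∀ q, 0 ≤ q → μ {y | q ≤ ‖y‖} ≤ ENNReal.ofReal (F q)) :
    Integrable (fun y => y) μ := by
  refine ⟨by fun_prop, ?_⟩
  rw [hasFiniteIntegral_iff_norm]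
  have h := lintegral_norm_sub_min_le hF hint hμ le_rfl
  simp only [min_eq_right (norm_nonneg _), sub_zero] at h
  exact h.trans_lt ENNReal.ofReal_lt_top

lemma integrable_clip (z : ℝ) (hz : 0 ≤ z) : Integrable (fun y : Batch d => clip z y) μ :=
  Integrable.of_bound (measurable_clip z).aestronglyMeasurable z
    (ae_of_all _ fun y => by rw [norm_clip hz]; exact min_le_right _ _)

/-- The bias of truncation at `z`. -/
lemma norm_integral_clip_sub_le (hF : IsTailFunction F) (hint : IntegrableOn F (Set.Ioi 0))
    (hμ : ∀ q, 0 ≤ q → μ {y | q ≤ ‖y‖} ≤ ENNReal.ofReal (F q)) {z : ℝ} (hz : 0 ≤ z) :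
    ‖∫ y, clip z y ∂μ - ∫ y, y ∂μ‖ ≤ ∫ q in Set.Ioi z, F q := by
  have hnn : 0 ≤ ∫ q in Set.Ioi z, F q :=
    setIntegral_nonneg measurableSet_Ioi fun q hq => (hF.mem_Icc q (hz.trans (le_of_lt hq))).1
  rw [norm_sub_rev, ← integral_sub (integrable_id_of_tail hF hint hμ) (integrable_clip z hz)]
  refine (norm_integral_le_integral_norm _).trans ?_
  simp_rw [norm_sub_clip hz]
  rw [integral_eq_lintegral_of_nonneg_ae (ae_of_all _ fun y => sub_nonneg.2 (min_le_left _ _))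
    (by fun_prop)]
  exact ENNReal.toReal_le_of_le_ofReal hnn (lintegral_norm_sub_min_le hF hint hμ hz)

lemma norm_integral_le_of_tail (hF : IsTailFunction F) (hint : IntegrableOn F (Set.Ioi 0))
    (hμ : ∀ q, 0 ≤ q → μ {y | q ≤ ‖y‖} ≤ ENNReal.ofReal (F q)) {z : ℝ} (hz : 0 ≤ z) :
    ‖∫ y, y ∂μ‖ ≤ z + ∫ q in Set.Ioi z, F q := by
  have h1 := norm_integral_clip_sub_le hF hint hμ hz
  have h2 : ‖∫ y, clip z y ∂μ‖ ≤ z := by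
    have := norm_integral_le_of_norm_le_const (μ := μ) (f := fun y : Batch d => clip z y) (C := z)
      (ae_of_all _ fun y => by rw [norm_clip hz]; exact min_le_right _ _)
    simpa using this
  have h3 := norm_sub_norm_le (∫ y, y ∂μ) (∫ y, clip z y ∂μ)
  rw [norm_sub_rev] at h3
  linarith

end TruncationBias

/-! ### Sample size and conclusion -/

section Assembly
variable {T d n : ℕ}

lemma batchMean_pi (X : Fin T → Measure (Batch d)) [∀ t, IsProbabilityMeasure (X t)] (t : Fin T) :
    batchMean (Measure.pi X) t = ∫ y, y ∂X t :=
  integral_comp_eval (μ := X) (f := fun y => y) (by fun_prop)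

/-- A deterministic estimator that succeeds on a likely set of clean data sets estimates the
mean. -/
lemma estimatesMean_of_typical {s : ℝ} {J : ℕ} {f : ℕ → ℝ} {D : Measure (Sample T d)}
    {ε err τ : ℝ} {G : Set (Data n T d)} (hG : MeasurableSet G)
    (hGD : ENNReal.ofReal (1 - τ) ≤ (Measure.pi fun _ : Fin n => D) G)
    (h : ∀ c ∈ G, ∀ x, IsCorruptedVersion ε c x →
      l2Dist ((layeredEstimator n T d s J f).run x ()) (batchMean D) ≤ err) :
    (layeredEstimator n T d s J f).EstimatesMean D ε err τ := by
  intro Ω _ P _ clean observed hclean _ hcorr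
  set A := layeredEstimator n T d s J f
  have h1 : {ω | clean ω ∈ G} ×ˢ (Set.univ : Set A.Seed) ⊆
      {p | l2Dist (A.run (observed p.1) p.2) (batchMean D) ≤ err} := by
    rintro ⟨ω, r⟩ hω
    exact h (clean ω) hω.1 (observed ω) (hcorr ω)
  refine le_trans ?_ (measure_mono h1)
  rw [Measure.prod_prod, measure_univ, mul_one, hclean.measure_eq (p := fun c => c ∈ G) hG]
  exact hGD

lemma two_mul_add_one_le_two_pow (d : ℕ) : 2 * d + 1 ≤ 2 ^ (2 * d) := by
  induction d with
  | zero => simp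
  | succ d ih =>
    rw [show 2 * (d + 1) = 2 * d + 2 by ring, pow_add]
    omega

lemma card_words_le (T d : ℕ) :
    (Fintype.card (Fin T → Letter d) : ℝ) ≤ 2 ^ (2 * (T * d ^ 2)) := by
  have h : Fintype.card (Fin T → Letter d) ≤ 2 ^ (2 * (T * d ^ 2)) := by
    simp only [Fintype.card_fun, Fintype.card_fin]
    calc ((2 * d + 1) ^ d) ^ T ≤ ((2 ^ (2 * d)) ^ d) ^ T := by
          gcongr
          exact two_mul_add_one_le_two_pow d
      _ = _ := by rw [← pow_mul, ← pow_mul]; congr 1; ring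
  exact_mod_cast h

/-- The number of samples suffices for a union bound over all layers and words. -/
lemma union_bound_le {N J R τ ε : ℝ} (hT : 0 < T) (hd : 0 < d) (hN : 1 ≤ N)
    (hN' : N ≤ 2 ^ (2 * (T * d ^ 2))) (hR : 0 < R) (hJ : J ≤ R * (1 + T)) (hτ : 0 < τ)
    (hε : 0 < ε)
    (hn : (2 : ℝ) ^ (7 * (T * d ^ 2)) * (1 / ε) ^ 2 * max 1 (Real.log (R / τ)) ≤ n) :
    J * (N * (2 * Real.exp (-2 * n * (ε / N) ^ 2))) ≤ τ := by
  set M := max 1 (Real.log (R / τ)) with hM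
  have hM1 : 1 ≤ M := le_max_left _ _
  set B : ℝ := 2 ^ (T * d ^ 2) with hB
  have hTB : (1 + T : ℝ) ≤ B := by
    have h1 : 1 + T ≤ 2 ^ (T * d ^ 2) := by
      calc 1 + T ≤ 2 ^ T := by have := Nat.lt_two_pow_self (n := T); omega
        _ ≤ 2 ^ (T * d ^ 2) := Nat.pow_le_pow_right (by norm_num)
          (Nat.le_mul_of_pos_right _ (by positivity))
    rw [hB]
    exact_mod_cast h1
  have hNB : N ≤ B ^ 2 := by
    rw [hB, ← pow_mul, mul_comm (T * d ^ 2) 2]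
    exact hN'
  have hB0 : 0 < B := by positivity
  have hn' : B ^ 7 * M ≤ n * ε ^ 2 := by
    have e : B ^ 7 = 2 ^ (7 * (T * d ^ 2)) := by rw [hB, ← pow_mul, mul_comm]
    rw [e]
    have := mul_le_mul_of_nonneg_right hn (sq_nonneg ε)
    calc _ = 2 ^ (7 * (T * d ^ 2)) * (1 / ε) ^ 2 * M * ε ^ 2 := by field_simp
      _ ≤ _ := this
  -- The union bound has `a * R` as prefactor. The exponent `7` comes from `N ^ 3 * (1 + T) ≤ B ^
  -- 7`: one factor `N` counts words and two come from the precision `ε / N`.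
  set a : ℝ := 2 * N * (1 + T) with ha
  have ha0 : 0 < a := by positivity
  have hX : a * M ≤ 2 * n * (ε / N) ^ 2 := by
    rw [div_pow, ← mul_div_assoc, le_div_iff₀ (by positivity)]
    calc a * M * N ^ 2 = 2 * (N ^ 3 * (1 + T) * M) := by rw [ha]; ring
      _ ≤ 2 * ((B ^ 2) ^ 3 * B * M) := by gcongr
      _ = 2 * (B ^ 7 * M) := by ring
      _ ≤ 2 * (n * ε ^ 2) := by gcongr
      _ = _ := by ring
  -- Uses `log a ≤ a - 1` and then `(a - 1) * (M - 1) ≥ 0`.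
  have hlog : Real.log (a * (R / τ)) ≤ a * M := by
    rw [Real.log_mul ha0.ne' (by positivity)]
    have h1 := Real.log_le_sub_one_of_pos ha0
    have h2 : Real.log (R / τ) ≤ M := le_max_right _ _
    have ha1 : 1 ≤ a := by nlinarith [(Nat.cast_nonneg T : (0 : ℝ) ≤ T)]
    nlinarith
  have hexp : a * (R / τ) ≤ Real.exp (2 * n * (ε / N) ^ 2) := by
    rw [← Real.log_le_iff_le_exp (by positivity)]
    exact hlog.trans hX
  rw [show -2 * (n : ℝ) * (ε / N) ^ 2 = -(2 * n * (ε / N) ^ 2) by ring, Real.exp_neg]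
  set e := Real.exp (2 * n * (ε / N) ^ 2)
  have he : 0 < e := Real.exp_pos _
  calc J * (N * (2 * e⁻¹)) ≤ R * (1 + T) * (N * (2 * e⁻¹)) := by gcongr
    _ = a * (R / τ) * (τ * e⁻¹) := by rw [ha]; field_simp
    _ ≤ e * (τ * e⁻¹) := by gcongr
    _ = τ := by field_simp

end Assembly

theorem theoremA2 :
    ∃ (ε₀ C : ℝ) (K : ℕ) (p : MvPolynomial (Fin 2) ℝ), 0 < ε₀ ∧ 0 < C ∧
      ∀ (T d : ℕ) (ε τ : ℝ) (F : ℝ → ℝ), 0 < T → 0 < d →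
        0 < ε → ε < 1 → ε ≤ ε₀ → 0 < τ → τ < 1 →
        IsTailFunction F →
        MeasureTheory.IntegrableOn (rateIntegrand F ε) (Set.Ioi 0) →
        ∀ n : ℕ,
          (2 : ℝ) ^ (K * (T * d ^ 2)) *
              MvPolynomial.eval ![1 / ε, 1 / F (cutoffL F ε T)] p *
              max 1 (Real.log (cutoffL F ε T / (rateQ F ε * τ))) ≤ (n : ℝ) →
          ∃ A : OnlineEstimator n T d, ∀ D : MeasureTheory.Measure (Sample T d),
            IsTailBoundBlock F D → A.EstimatesMean D ε (C * rateQ F ε) τ := by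
  refine ⟨1 / 96, 10 ^ 6, 7, MvPolynomial.X 0 ^ 2, by norm_num, by norm_num, ?_⟩
  intro T d ε τ F hT hd hε hε1 hε0 hτ hτ1 hF hint n hn
  have hQ0 : 0 ≤ rateQ F ε := rateQ_nonneg hε
  have hFi := hF.integrableOn hε hε1.le hint
  have hL0 : 0 ≤ cutoffL F ε T := cutoffL_nonneg
  have hT' : 0 < Real.sqrt T := by positivity
  have htail := fun z => integral_Ioi_le_of_cutoffL_lt (z := z) hF hε hε1.le hint hT
  simp only [map_pow, MvPolynomial.eval_X, Matrix.cons_val_zero] at hn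
  set Q := rateQ F ε with hQ
  set L := cutoffL F ε T with hL
  rcases le_or_gt L (Q / Real.sqrt T) with hLQ | hLQ
  -- Zero layers give the constant estimate `0`, which suffices: each true mean has norm at most `L
  -- + Q / √T ≤ 2 * Q / √T`.
  · refine ⟨layeredEstimator n T d 1 0 0, fun D hD => ?_⟩
    obtain ⟨X, hX, rfl, hXF⟩ := hD
    refine estimatesMean_of_typical MeasurableSet.univ ?_ fun c _ x _ => ?_
    · rw [measure_univ, ← ENNReal.ofReal_one]
      exact ENNReal.ofReal_le_ofReal (by linarith)
    · refine (l2Dist_le_of_forall_le (b := 2 * Q) (by positivity) fun t => ?_).trans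
        (by linarith)
      have h0 : (layeredEstimator n T d 1 0 0).run x () t = 0 := by
        simp [OnlineEstimator.run, layeredEstimator]
      rw [h0, zero_sub, norm_neg, batchMean_pi]
      refine le_of_forall_pos_le_add fun η hη => ?_
      have h1 := norm_integral_le_of_tail hF hFi (hXF t) (z := L + η) (by positivity)
      have h2 := htail (L + η) (by linarith)
      rw [mul_div_assoc]
      linarith
  · have hQpos : 0 < Q := by
      refine hQ0.lt_of_ne fun h => ?_
      have := cutoffL_eq_zero_of_rateQ hF hε hε1.le hint T h.symm
      rw [← hL] at this
      rw [this, ← h, zero_div] at hLQ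
      exact lt_irrefl _ hLQ
    have hLpos : 0 < L := lt_trans (by positivity) hLQ
    -- With this width the boundary term `s * ε` of the Riemann sum is exactly `Q`.
    set s := Q / ε with hs
    have hs0 : 0 < s := by positivity
    -- The `+ 1` puts the truncation point `J * s` strictly beyond `L`, as `htail` requires.
    set J := ⌊L / s⌋₊ + 1 with hJ
    have hJL : L < J * s := by
      rw [← div_lt_iff₀ hs0, hJ]
      exact_mod_cast Nat.lt_floor_add_one (L / s)
    have hn0 : 0 < n := by
      have : (0 : ℝ) < n := lt_of_lt_of_le (by positivity) hn
      exact_mod_cast this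
    have hJR : (J : ℝ) ≤ L / Q * (1 + T) := by
      have h1 : (⌊L / s⌋₊ : ℝ) ≤ L / s := Nat.floor_le (by positivity)
      have h2 : L / s ≤ L / Q := by
        rw [hs, div_div_eq_mul_div]
        gcongr
        exact mul_le_of_le_one_right hLpos.le hε1.le
      -- The case assumption `Q / √T < L` absorbs the extra layer, so that the number of layers is
      -- governed by `L / Q`.
      have h3 : 1 ≤ L / Q * T := by
        have h4 : Real.sqrt T ≤ T := by
          rw [Real.sqrt_le_left (by positivity)]
          have : (1 : ℝ) ≤ T := by exact_mod_cast hT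
          nlinarith
        rw [div_lt_iff₀ hT'] at hLQ
        rw [div_mul_eq_mul_div, one_le_div hQpos]
        exact hLQ.le.trans (by gcongr)
      rw [hJ]
      push_cast
      linarith
    refine ⟨layeredEstimator n T d s J fun j => F (j * s), fun D hD => ?_⟩
    obtain ⟨X, hX, rfl, hXF⟩ := hD
    refine estimatesMean_of_typical (measurableSet_typicalData s ε J X) ?_ fun c hc x hx => ?_
    · have h1 := (measureReal_compl_typicalData_le hs0 hε.le hn0 J X).trans
        (union_bound_le (R := L / Q) hT hd (by exact_mod_cast Fintype.card_pos)
          (card_words_le T d) (by positivity) hJR hτ hε (by rwa [div_div]))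
      rw [measureReal_compl (measurableSet_typicalData s ε J X), probReal_univ] at h1
      exact ENNReal.ofReal_le_of_le_toReal (by rw [← measureReal_def]; linarith)
    · have h1 := l2Dist_layeredEstimator_le hs0 hε hε0 hn0
        (fun j => (hF.mem_Icc (j * s) (by positivity)).1) X
        (fun t j => hXF t (j * s) (by positivity)) hc hx
      have h2 : l2Dist (fun t => ∫ y, clip (J * s) y ∂X t) (batchMean (Measure.pi X)) ≤ Q :=
        l2Dist_le_of_forall_le hQ0 fun t => by
          rw [batchMean_pi]
          exact (norm_integral_clip_sub_le hF hFi (hXF t) (by positivity)).trans (htail _ hJL)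
      have h3 := sum_rateIntegrand_le hF hε hint hs0 J
      have h4 : s * ε = Q := by rw [hs]; field_simp
      rw [h4] at h3
      -- Layers cost at most `10 ^ 5 * (2 * Q)` and truncation at most `Q`.
      refine (l2Dist_triangle _ (fun t => ∫ y, clip (J * s) y ∂X t) _).trans ?_
      change ∑ j ∈ Finset.range J, s * min ε (Real.sqrt (ε * F (j * s))) ≤ Q + Q at h3
      linarith
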